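/- Write $[n]=\{1,\dots,n\}$ and let $\binom{[n]}{r}$ be the set of $r$-element subsets of $[n]$. For $\mathcal F\subseteq\binom{[n]}{r}$ let $\deg_{\mathcal F}(x)=|\{E\in\mathcal F: x\in E\}|$, $\Delta(\mathcal F)=\max_{x\in[n]}\deg_{\mathcal F}(x)$ and, for real $C$, $d_C(\mathcal F)=|\mathcal F|-C\cdot\Delta(\mathcal F)$. Let $$\mathbb F=\{124,137,156,235,267,346,457\}$$ be the Fano plane on $[7]$ (where $124$ stands for $\{1,2,4\}$, etc.), let $\mathbb F^{c}=\{[7]\setminus L: L\in\mathbb F\}$, and let $\mathbb F^+=\mathbb F\cup\bigl(\binom{[7]}{4}\setminus\mathbb F^{c}\bigr)$. Put $$\mathcal A_{\mathbb F}=\Bigl\{E\in\tbinom{[n]}{r}: E\cap[7]\in\mathbb F\Bigr\},\qquad \mathcal A_{\mathbb F^+}=\Bigl\{E\in\tbinom{[n]}{r}: E\cap[7]\in\mathbb F^+\Bigr\}.$$ **Theorem.** Fix an integer $r\ge 3$ and a real number $C$ with $\frac32\le C<\frac73$, and assume $(r,C)\ne(3,\frac32)$. There is $n_0=n_0(r,C)$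 such that the following holds for all $n\ge n_0$. Let $\mathcal F\subseteq\binom{[n]}{r}$ be an intersecting family (any two edges meet) for which $d_C(\mathcal F)$ is maximum among all intersecting subfamilies of $\binom{[n]}{r}$. Then, after a suitable permutation of the vertex set $[n]$: 1. if $\frac32\le C<\frac74$, then $\mathcal F=\mathcal A_{\mathbb F^+}$; 2. if $C=\frac74$, then $\mathcal A_{\mathbb F}\subseteq\mathcal F\subseteq\mathcal A_{\mathbb F^+}$, and the edges of $\mathcal E=\mathcal F\setminus\mathcal A_{\mathbb F}$ contribute zero to the $C$-weighted diversity: $|\mathcal E|-C\cdot\deg_{\mathcal E}(v)=0$ for each of the seven vertices $v\in[7]$, and $d_C(\mathcal F)=d_C(\mathcal A_{\mathbb F})$; 3. if $\frac74<C<\frac73$, then $\mathcal F=\mathcal A_{\mathbb F}$. -/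

import Mathlib

namespace Diversity

open Finset

/-- The degree of the vertex `x` in the family `F`: the number of edges containing `x`. -/
def degree (F : Finset (Finset ℕ)) (x : ℕ) : ℕ :=
  (F.filter fun E => x ∈ E).card

/-- The maximum degree `Δ(F)` of a family on the vertex set `[n] = {1, …, n}`. -/
def maxDegree (n : ℕ) (F : Finset (Finset ℕ)) : ℕ :=
  (Icc 1 n).sup (degree F)

/-- The `C`-weighted diversity `d_C(F) = |F| - C · Δ(F)`. -/
noncomputable def diversity (n : ℕ) (C : ℝ) (F : Finset (Finset ℕ)) : ℝ :=
  (F.card : ℝ) - C * (maxDegree n F : ℝ)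

/-- `F` is an intersecting family of `r`-element subsets of `[n]`. -/
def IsIntersectingFamily (n r : ℕ) (F : Finset (Finset ℕ)) : Prop :=
  F ⊆ (Icc 1 n).powersetCard r ∧ ∀ A ∈ F, ∀ B ∈ F, (A ∩ B).Nonempty

/-- `F` has the maximum `C`-weighted diversity among all intersecting families of
`r`-element subsets of `[n]`. -/
def IsExtremal (n r : ℕ) (C : ℝ) (F : Finset (Finset ℕ)) : Prop :=
  IsIntersectingFamily n r F ∧
    ∀ G, IsIntersectingFamily n r G → diversity n C G ≤ diversity n C F

/-- The Fano plane on `[7]`. -/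
def fano : Finset (Finset ℕ) :=
  {{1, 2, 4}, {1, 3, 7}, {1, 5, 6}, {2, 3, 5}, {2, 6, 7}, {3, 4, 6}, {4, 5, 7}}

/-- The complements in `[7]` of the lines of the Fano plane. -/
def fanoCompl : Finset (Finset ℕ) :=
  fano.image fun L => Icc 1 7 \ L

/-- The Fano plane together with the `4`-subsets of `[7]` that are not complements of lines,
that is, the `4`-subsets of `[7]` that meet every line. -/
def fanoPlus : Finset (Finset ℕ) :=
  fano ∪ ((Icc 1 7).powersetCard 4 \ fanoCompl)

/-- The family of the `r`-subsets of `[n]` whose trace on `[7]` is a line of the Fano plane. -/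
def familyFano (n r : ℕ) : Finset (Finset ℕ) :=
  ((Icc 1 n).powersetCard r).filter fun E => E ∩ Icc 1 7 ∈ fano

/-- The family of the `r`-subsets of `[n]` whose trace on `[7]` is in `fanoPlus`. -/
def familyFanoPlus (n r : ℕ) : Finset (Finset ℕ) :=
  ((Icc 1 n).powersetCard r).filter fun E => E ∩ Icc 1 7 ∈ fanoPlus

/-- The image of a family under a relabelling of the vertices. -/
def relabel (σ : Equiv.Perm ℕ) (F : Finset (Finset ℕ)) : Finset (Finset ℕ) :=
  F.image fun E => E.image σ

/-- `σ` restricts to a permutation of the vertex set `[n]`. -/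
def PermutesVertices (n : ℕ) (σ : Equiv.Perm ℕ) : Prop :=
  ∀ x, σ x ∈ Icc 1 n ↔ x ∈ Icc 1 n

/-- `F` and `G` are isomorphic as families on `[n]`. -/
def Isomorphic (n : ℕ) (F G : Finset (Finset ℕ)) : Prop :=
  ∃ σ : Equiv.Perm ℕ, PermutesVertices n σ ∧ F = relabel σ G

end Diversity

/-! Write M for `(n - 3).choose (r - 3)`; error terms have order n^(r-4). Two observations drive the
proof. First, Δ is at least the average degree over any vertex set X, so d_C(F) is at most the sum
over the edges of the weight 1 - C|E ∩ X|/|X| (`diversity_le_sum`). Second, call a triple heavy if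
its codegree exceeds about r·n^(r-4). A heavy triple meets every edge of an intersecting family,
heavy triples meet one another, and if no two vertices cover F then all but O(n^(r-4)) edges contain
a heavy triple. To leading order F is therefore governed by an intersecting 3-graph H.

If H has no cover by two vertices, it contains a Fano plane, lives on six vertices, or has a 4-set
meeting every triple twice (`fano_or_sextuple_or_quadruple`). Averaging over the 4-set, or over the
6-set when |H| ≤ 9, gives d_2 ≤ o(M) and d_{3/2} ≤ (9/4 + o(1))M. The same bounds hold when two
vertices cover F or H; there the value 9/4 comes from a third vertex that almost all edges through
exactly one of the two would have to share (`exists_common_vertex`). Since d_C is affine in C, these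
bounds interpolate to less than the value (7 - 3C + o(1))M of the Fano family.

If H has ten triples on six vertices, then d_C(F) ≤ (10 - 5C)·binom(n-6, r-3) for 3/2 ≤ C ≤ 2. This
ties with 7 - 3C at leading order exactly for C = 3/2, where `familyFanoPlus` wins by its
lower-order term if r ≥ 4; for r = 3 there is no such term, which explains the excluded pair.

If H contains a Fano plane, put it on [7]. Every edge meets every line, so its trace is a line, a
4-set of `fanoPlus`, or has size at least 5. The weights 1 - 3C/7, 1 - 4C/7, 1 - 5C/7 have signs
that change at 7/3, 7/4, 7/5. Both Fano families are regular on [7] with maximum degree attained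
there, so averaging is exact for them, and comparing sums of weights determines F. -/

namespace Diversity
open Finset

/-! ### Codegrees and the averaging bound -/

/-- The number of edges of `F` that contain `K`. -/
def codegree (F : Finset (Finset ℕ)) (K : Finset ℕ) : ℕ :=
  (F.filter fun E => K ⊆ E).card

theorem card_trace_eq (S A T : Finset ℕ) (r : ℕ) (hA : A ⊆ S) (hT : T ⊆ A) :
    ((S.powersetCard r).filter fun E => E ∩ A = T).card =
      if T.card ≤ r then (S.card - A.card).choose (r - T.card) else 0 := by
  split_ifs with h
  · rw [← card_sdiff_of_subset hA, ← card_powersetCard]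
    refine card_bij' (fun E _ => E \ A) (fun E _ => E ∪ T) ?_ ?_ ?_ ?_
    · intro E hE
      simp only [mem_filter, mem_powersetCard] at hE ⊢
      obtain ⟨⟨h1, h2⟩, h3⟩ := hE
      refine ⟨sdiff_subset_sdiff h1 le_rfl, ?_⟩
      have := card_sdiff_add_card_inter E A
      rw [h3] at this
      omega
    · intro E hE
      simp only [mem_filter, mem_powersetCard] at hE ⊢
      obtain ⟨h1, h2⟩ := hE
      have hd : Disjoint E T := by
        refine disjoint_left.2 fun x hx hx' => ?_
        exact (mem_sdiff.1 (h1 hx)).2 (hT hx')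
      refine ⟨⟨union_subset (h1.trans sdiff_subset) (hT.trans hA), ?_⟩, ?_⟩
      · rw [card_union_of_disjoint hd]; omega
      · ext x
        simp only [mem_inter, mem_union]
        constructor
        · rintro ⟨hx | hx, hxA⟩
          · exact absurd hxA (mem_sdiff.1 (h1 hx)).2
          · exact hx
        · intro hx
          exact ⟨Or.inr hx, hT hx⟩
    · intro E hE
      simp only [mem_filter] at hE
      rw [← hE.2]
      exact sdiff_union_inter E A
    · intro E hE
      rw [mem_powersetCard] at hE
      ext x
      simp only [mem_sdiff, mem_union]
      constructor
      · rintro ⟨hx | hx, hxA⟩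
        · exact hx
        · exact absurd (hT hx) hxA
      · intro hx
        exact ⟨Or.inl hx, (mem_sdiff.1 (hE.1 hx)).2⟩
  · rw [card_eq_zero, filter_eq_empty_iff]
    intro E hE hE'
    rw [mem_powersetCard] at hE
    have := card_le_card (inter_subset_left : E ∩ A ⊆ E)
    rw [hE'] at this
    omega

variable {n r : ℕ} {F : Finset (Finset ℕ)}

theorem codegree_le_card_superset (hF : F ⊆ (Icc 1 n).powersetCard r) (K : Finset ℕ) :
    codegree F K ≤ if K.card ≤ r then (n - K.card).choose (r - K.card) else 0 := by
  by_cases hK : K ⊆ Icc 1 n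
  · have := card_trace_eq (Icc 1 n) K K r hK Subset.rfl
    rw [Nat.card_Icc, Nat.add_sub_cancel] at this
    rw [← this]
    refine card_le_card fun E hE => ?_
    rw [mem_filter] at hE ⊢
    exact ⟨hF hE.1, inter_eq_right.2 hE.2⟩
  · have : codegree F K = 0 := by
      rw [codegree, card_eq_zero, filter_eq_empty_iff]
      intro E hE hKE
      exact hK (hKE.trans (mem_powersetCard.1 (hF hE)).1)
    rw [this]
    exact Nat.zero_le _

theorem codegree_le_choose (hr : 3 ≤ r) (hF : F ⊆ (Icc 1 n).powersetCard r) {K : Finset ℕ}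
    (hK : K.card = 3) : codegree F K ≤ (n - 3).choose (r - 3) := by
  have := codegree_le_card_superset hF K
  rwa [hK, if_pos hr] at this

/-- The codegree of a 4-set is at most n^(r-4). Error terms of this order carry an extra factor n
throughout, which avoids the truncated exponent `r - 4` at r = 3, where the codegree is 0. -/
theorem mul_codegree_le_pow (hF : F ⊆ (Icc 1 n).powersetCard r) {K : Finset ℕ}
    (hK : K.card = 4) : n * codegree F K ≤ n ^ (r - 3) := by
  have := codegree_le_card_superset hF K
  rw [hK] at this
  split_ifs at this with h
  · calc n * codegree F K ≤ n * n ^ (r - 4) := by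
          gcongr
          refine this.trans ((Nat.choose_le_pow _ _).trans ?_)
          gcongr
          omega
      _ = n ^ (r - 3) := by rw [← pow_succ']; congr 1; omega
  · rw [Nat.le_zero.1 this]; simp

theorem card_le_sum_codegree {G : Finset (Finset ℕ)} (hG : G ⊆ F) (T : Finset (Finset ℕ))
    (h : ∀ E ∈ G, ∃ K ∈ T, K ⊆ E) : G.card ≤ ∑ K ∈ T, codegree F K := by
  calc G.card ≤ (T.biUnion fun K => F.filter fun E => K ⊆ E).card := by
        refine card_le_card fun E hE => ?_
        obtain ⟨K, hK, hKE⟩ := h E hE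
        exact mem_biUnion.2 ⟨K, hK, mem_filter.2 ⟨hG hE, hKE⟩⟩
    _ ≤ _ := card_biUnion_le

theorem degree_le_maxDegree {x : ℕ} (hx : x ∈ Icc 1 n) : degree F x ≤ maxDegree n F :=
  Finset.le_sup (f := degree F) hx

theorem maxDegree_mono {G : Finset (Finset ℕ)} (h : G ⊆ F) : maxDegree n G ≤ maxDegree n F :=
  Finset.sup_mono_fun fun _ _ => card_le_card (filter_subset_filter _ h)

theorem diversity_le_add_card {C : ℝ} (hC : 0 ≤ C) {G : Finset (Finset ℕ)} (h : G ⊆ F) :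
    diversity n C F ≤ diversity n C G + ((F \ G).card : ℝ) := by
  have h1 : (maxDegree n G : ℝ) ≤ maxDegree n F := by exact_mod_cast maxDegree_mono h
  have h2 : ((F \ G).card : ℝ) + G.card = F.card := by
    exact_mod_cast card_sdiff_add_card_eq_card h
  have := mul_le_mul_of_nonneg_left h1 hC
  simp only [diversity]
  linarith

theorem sum_degree_eq (F : Finset (Finset ℕ)) (X : Finset ℕ) :
    ∑ x ∈ X, degree F x = ∑ E ∈ F, (E ∩ X).card := by
  simp only [degree, card_filter]
  rw [sum_comm]
  refine sum_congr rfl fun E _ => ?_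
  rw [← card_filter]
  congr 1
  ext x
  simp [and_comm]

/-- The maximum degree is at least the average degree over X; double counting turns that average
into a sum over edges. -/
theorem diversity_le_sum {C : ℝ} (hC : 0 ≤ C) {X : Finset ℕ} (hX : X ⊆ Icc 1 n)
    (hX' : X.Nonempty) (F : Finset (Finset ℕ)) :
    diversity n C F ≤ ∑ E ∈ F, (1 - C * ((E ∩ X).card / X.card)) := by
  have h0 : (0 : ℝ) < X.card := by exact_mod_cast hX'.card_pos
  have h1 : ∑ x ∈ X, degree F x ≤ X.card * maxDegree n F := by
    rw [← smul_eq_mul]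
    exact sum_le_card_nsmul _ _ _ fun x hx => degree_le_maxDegree (hX hx)
  rw [sum_degree_eq] at h1
  have h2 : ∑ E ∈ F, ((E ∩ X).card : ℝ) ≤ X.card * maxDegree n F := by exact_mod_cast h1
  have h3 : (∑ E ∈ F, ((E ∩ X).card : ℝ)) / X.card ≤ maxDegree n F := by
    rwa [div_le_iff₀' h0]
  rw [sum_sub_distrib, ← mul_sum, ← sum_div, sum_const, nsmul_eq_mul, mul_one]
  have := mul_le_mul_of_nonneg_left h3 hC
  simp only [diversity]
  linarith

end Diversity

/-! ### Intersecting 3-graphs without a 2-cover: the linear case -/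

namespace Diversity
open Finset

theorem inter_triple_nonempty {E : Finset ℕ} {x y z : ℕ} (h : (E ∩ {x, y, z}).Nonempty) :
    x ∈ E ∨ y ∈ E ∨ z ∈ E := by
  obtain ⟨w, hw⟩ := h
  simp only [mem_inter, mem_insert, mem_singleton] at hw
  obtain ⟨hw, rfl | rfl | rfl⟩ := hw <;> simp [hw]

theorem eq_triple {E : Finset ℕ} {x y z : ℕ} (h : E.card = 3) (hx : x ∈ E) (hy : y ∈ E)
    (hz : z ∈ E) (hxy : x ≠ y) (hxz : x ≠ z) (hyz : y ≠ z) : E = {x, y, z} := by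
  symm
  apply eq_of_subset_of_card_le
  · intro w hw
    simp only [mem_insert, mem_singleton] at hw
    obtain rfl | rfl | rfl := hw <;> assumption
  · rw [h, card_eq_three.2 ⟨x, y, z, hxy, hxz, hyz, rfl⟩]

theorem exists_third {E : Finset ℕ} {x y : ℕ} (h : E.card = 3) (hx : x ∈ E) (hy : y ∈ E)
    (hxy : x ≠ y) : ∃ z, z ≠ x ∧ z ≠ y ∧ E = {x, y, z} := by
  have : 0 < (E \ {x, y}).card := by
    have := le_card_sdiff {x, y} E
    have := card_le_two (a := x) (b := y)
    omega
  obtain ⟨z, hz⟩ := card_pos.1 this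
  simp only [mem_sdiff, mem_insert, mem_singleton, not_or] at hz
  exact ⟨z, hz.2.1, hz.2.2, eq_triple h hx hy hz.1 hxy (Ne.symm hz.2.1) (Ne.symm hz.2.2)⟩

theorem exists_other_two {E : Finset ℕ} {x : ℕ} (h : E.card = 3) (hx : x ∈ E) :
    ∃ y z, y ≠ x ∧ z ≠ x ∧ y ≠ z ∧ E = {x, y, z} := by
  have : 0 < (E \ {x}).card := by
    have := le_card_sdiff {x} E
    rw [card_singleton] at this
    omega
  obtain ⟨y, hy⟩ := card_pos.1 this
  rw [mem_sdiff, mem_singleton] at hy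
  obtain ⟨z, h1, h2, h3⟩ := exists_third h hx hy.1 (Ne.symm hy.2)
  exact ⟨y, z, hy.2, h1, Ne.symm h2, h3⟩

theorem card_quadruple {x y z w : ℕ} (hxy : x ≠ y) (hxz : x ≠ z) (hxw : x ≠ w) (hyz : y ≠ z)
    (hyw : y ≠ w) (hzw : z ≠ w) : ({x, y, z, w} : Finset ℕ).card = 4 := by
  rw [card_insert_of_notMem (by simp [*]), card_eq_three.2 ⟨y, z, w, hyz, hyw, hzw, rfl⟩]

theorem two_le_card_inter {E X : Finset ℕ} {x y : ℕ} (hxy : x ≠ y) (hx : x ∈ E) (hy : y ∈ E)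
    (hx' : x ∈ X) (hy' : y ∈ X) : 2 ≤ (E ∩ X).card := by
  rw [← card_pair hxy]
  apply card_le_card
  intro w hw
  simp only [mem_insert, mem_singleton] at hw
  obtain rfl | rfl := hw <;> simp [*]

theorem exists_fano_map {H : Finset (Finset ℕ)} {v a a' b b' c c' : ℕ}
    (hnd : [v, a, b, a', c, c', b'].Nodup) (hA : {v, a, a'} ∈ H) (hB : {v, b, b'} ∈ H)
    (hD : {v, c, c'} ∈ H) (hT : {a, b, c} ∈ H) (hP : {a, b', c'} ∈ H) (hQ : {a', b, c'} ∈ H)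
    (hR : {a', b', c} ∈ H) :
    ∃ f : ℕ → ℕ, Set.InjOn f (Icc 1 7 : Finset ℕ) ∧ ∀ L ∈ fano, L.image f ∈ H := by
  -- The list gives the images of 1, …, 7 in order, chosen so that 124, 137, 156 become the lines
  -- through v and 235 becomes abc. The default 0 is never reached on [7].
  refine ⟨fun i => [v, a, b, a', c, c', b'].getD (i - 1) 0, ?_, ?_⟩
  · intro i hi j hj hij
    rw [Finset.coe_Icc, Set.mem_Icc] at hi hj
    dsimp only at hij
    rw [List.getD_eq_getElem _ _ (by simp only [List.length_cons, List.length_nil]; omega),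
      List.getD_eq_getElem _ _ (by simp only [List.length_cons, List.length_nil]; omega),
      hnd.getElem_inj_iff] at hij
    omega
  · intro L hL
    simp only [fano, mem_insert, mem_singleton] at hL
    obtain rfl | rfl | rfl | rfl | rfl | rfl | rfl := hL <;>
      simp only [image_insert, image_singleton, Nat.add_one_sub_one,
        List.getD_cons_succ, List.getD_cons_zero]
    · exact hA
    · exact hB
    · exact hD
    · exact hT
    · rwa [pair_comm c' b']
    · rwa [Finset.insert_comm]
    · rwa [pair_comm c b']

section Structure

variable {H : Finset (Finset ℕ)} (hint : ∀ A ∈ H, ∀ B ∈ H, (A ∩ B).Nonempty)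
  (h3 : ∀ E ∈ H, E.card = 3) (hcov : ∀ x y, ∃ E ∈ H, x ∉ E ∧ y ∉ E)

include hint in
theorem mem_of_triple_mem {E : Finset ℕ} {x y z : ℕ} (hE : E ∈ H) (h : {x, y, z} ∈ H) :
    x ∈ E ∨ y ∈ E ∨ z ∈ E :=
  inter_triple_nonempty (hint E hE _ h)

-- A line avoiding two points of K0 passes through the third. This yields lines K1 through c and K2
-- through b, which share a point d. A line avoiding a and d passes through b or c, where it is the
-- third line.
include hint h3 hcov in
theorem exists_three_lines
    (hlin : ∀ K ∈ H, ∀ L ∈ H, ∀ x y, x ≠ y → x ∈ K → y ∈ K → x ∈ L → y ∈ L → K = L) :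
    ∃ v, ∃ A ∈ H, ∃ B ∈ H, ∃ D ∈ H, v ∈ A ∧ v ∈ B ∧ v ∈ D ∧ A ≠ B ∧ A ≠ D ∧ B ≠ D := by
  obtain ⟨K0, hK0, -⟩ := hcov 0 0
  obtain ⟨a, b, c, hab, hac, hbc, rfl⟩ := card_eq_three.1 (h3 K0 hK0)
  have M : ∀ {E : Finset ℕ} {x y z : ℕ}, E ∈ H → {x, y, z} ∈ H → x ∈ E ∨ y ∈ E ∨ z ∈ E :=
    fun h1 h2 => mem_of_triple_mem hint h1 h2
  obtain ⟨K1, hK1, h1a, h1b⟩ := hcov a b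
  have h1c : c ∈ K1 := by have := M hK1 hK0; tauto
  obtain ⟨d, e, hdc, hec, hde, rfl⟩ := exists_other_two (h3 _ hK1) h1c
  obtain ⟨K2, hK2, h2a, h2c⟩ := hcov a c
  have h2b : b ∈ K2 := by have := M hK2 hK0; tauto
  have key : ∀ d e, d ≠ c → e ≠ c → d ≠ e → {c, d, e} ∈ H → a ∉ ({c, d, e} : Finset ℕ) →
      b ∉ ({c, d, e} : Finset ℕ) → d ∈ K2 →
      ∃ v, ∃ A ∈ H, ∃ B ∈ H, ∃ D ∈ H, v ∈ A ∧ v ∈ B ∧ v ∈ D ∧ A ≠ B ∧ A ≠ D ∧ B ≠ D := by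
    clear hde hec hdc h1b h1a hK1 h1c d e
    intro d e hdc hec hde hK1 h1a h1b h2d
    simp only [mem_insert, mem_singleton, not_or] at h1a h1b
    obtain ⟨f, hfb, hfd, rfl⟩ := exists_third (h3 _ hK2) h2b h2d h1b.2.1
    have hfe : f ≠ e := by
      rintro rfl
      have := hlin _ hK1 _ hK2 d f hde (by simp) (by simp) (by simp) (by simp)
      have : c ∈ ({b, d, f} : Finset ℕ) := this ▸ (by simp)
      exact h2c this
    simp only [mem_insert, mem_singleton, not_or] at h2a h2c
    obtain ⟨K3, hK3, h3b, h3c⟩ := hcov b c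
    have h3a : a ∈ K3 := by have := M hK3 hK0; tauto
    by_cases h3d : d ∈ K3
    · refine ⟨d, _, hK1, _, hK2, K3, hK3, by simp, by simp, h3d, ?_, ?_, ?_⟩
      · intro h
        have : c ∈ ({b, d, f} : Finset ℕ) := h ▸ (by simp)
        simp only [mem_insert, mem_singleton] at this; omega
      · rintro rfl; simp at h3c
      · rintro rfl; simp at h3b
    have h3e : e ∈ K3 := by have := M hK3 hK1; tauto
    have h3f : f ∈ K3 := by have := M hK3 hK2; tauto
    obtain ⟨K4, hK4, h4a, h4d⟩ := hcov a d
    by_cases h4c : c ∈ K4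
    · refine ⟨c, _, hK0, _, hK1, K4, hK4, by simp, by simp, h4c, ?_, ?_, ?_⟩
      · intro h
        have : b ∈ ({c, d, e} : Finset ℕ) := h ▸ (by simp)
        simp only [mem_insert, mem_singleton] at this; omega
      · rintro rfl; simp at h4a
      · rintro rfl; simp at h4d
    have h4b : b ∈ K4 := by have := M hK4 hK0; tauto
    refine ⟨b, _, hK0, _, hK2, K4, hK4, by simp, by simp, h4b, ?_, ?_, ?_⟩
    · intro h
      have : c ∈ ({b, d, f} : Finset ℕ) := h ▸ (by simp)
      simp only [mem_insert, mem_singleton] at this; omega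
    · rintro rfl; simp at h4a
    · rintro rfl; simp at h4d
  have : d ∈ K2 ∨ e ∈ K2 := by
    have := M hK2 hK1
    tauto
  obtain h | h := this
  · exact key d e hdc hec hde hK1 h1a h1b h
  · rw [pair_comm d e] at hK1 h1a h1b
    exact key e d hec hdc (Ne.symm hde) hK1 h1a h1b h

-- Take three lines through v and a line T = abc avoiding v. Linearity forces every edge to be one
-- of the seven lines of the Fano plane these determine. If all seven occur, this is the Fano plane.
-- Otherwise the complement of a missing line is a 4-set that meets each other line in two points.
set_option maxHeartbeats 1000000 in
include hint h3 hcov in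
theorem fano_or_of_linear
    (hlin : ∀ K ∈ H, ∀ L ∈ H, ∀ x y, x ≠ y → x ∈ K → y ∈ K → x ∈ L → y ∈ L → K = L) :
    (∃ f : ℕ → ℕ, Set.InjOn f (Icc 1 7 : Finset ℕ) ∧ ∀ L ∈ fano, L.image f ∈ H) ∨
      ∃ X ⊆ H.biUnion id, X.card = 4 ∧ ∀ K ∈ H, 2 ≤ (K ∩ X).card := by
  have M : ∀ {E : Finset ℕ} {x y z : ℕ}, E ∈ H → {x, y, z} ∈ H → x ∈ E ∨ y ∈ E ∨ z ∈ E :=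
    fun h1 h2 => mem_of_triple_mem hint h1 h2
  obtain ⟨v, A, hA, B, hB, D, hD, hvA, hvB, hvD, hAB, hAD, hBD⟩ :=
    exists_three_lines hint h3 hcov hlin
  obtain ⟨T, hT, hvT, -⟩ := hcov v v
  have pick : ∀ K ∈ H, v ∈ K → ∃ a a', a ≠ v ∧ a' ≠ v ∧ a ≠ a' ∧ K = {v, a, a'} ∧ a ∈ T := by
    intro K hK hvK
    obtain ⟨y, z, hy, hz, hyz, rfl⟩ := exists_other_two (h3 K hK) hvK
    obtain h | h | h := M hT hK
    · exact absurd h hvT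
    · exact ⟨y, z, hy, hz, hyz, rfl, h⟩
    · exact ⟨z, y, hz, hy, hyz.symm, by rw [pair_comm], h⟩
  have third : ∀ K ∈ H, ∀ L ∈ H, K ≠ L → v ∈ K → v ∈ L → ∀ w, w ≠ v → w ∈ K → w ∈ L → False :=
    fun K hK L hL hKL h1 h2 w hw h4 h5 => hKL (hlin K hK L hL v w hw.symm h1 h4 h2 h5)
  obtain ⟨a, a', hav, hav', haa, rfl, haT⟩ := pick A hA hvA
  obtain ⟨b, b', hbv, hbv', hbb, rfl, hbT⟩ := pick B hB hvB
  obtain ⟨c, c', hcv, hcv', hcc, rfl, hcT⟩ := pick D hD hvD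
  have t1 := third _ hA _ hB hAB hvA hvB
  have t2 := third _ hA _ hD hAD hvA hvD
  have t3 := third _ hB _ hD hBD hvB hvD
  clear third pick
  have hab : a ≠ b := by rintro rfl; exact t1 a hav (by simp) (by simp)
  have hab' : a ≠ b' := by rintro rfl; exact t1 a hav (by simp) (by simp)
  have ha'b : a' ≠ b := by rintro rfl; exact t1 a' hav' (by simp) (by simp)
  have ha'b' : a' ≠ b' := by rintro rfl; exact t1 a' hav' (by simp) (by simp)
  have hac : a ≠ c := by rintro rfl; exact t2 a hav (by simp) (by simp)
  have hac' : a ≠ c' := by rintro rfl; exact t2 a hav (by simp) (by simp)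
  have ha'c : a' ≠ c := by rintro rfl; exact t2 a' hav' (by simp) (by simp)
  have ha'c' : a' ≠ c' := by rintro rfl; exact t2 a' hav' (by simp) (by simp)
  have hbc : b ≠ c := by rintro rfl; exact t3 b hbv (by simp) (by simp)
  have hbc' : b ≠ c' := by rintro rfl; exact t3 b hbv (by simp) (by simp)
  have hb'c : b' ≠ c := by rintro rfl; exact t3 b' hbv' (by simp) (by simp)
  have hb'c' : b' ≠ c' := by rintro rfl; exact t3 b' hbv' (by simp) (by simp)
  clear t1 t2 t3
  obtain rfl := eq_triple (h3 T hT) haT hbT hcT hab hac hbc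
  have hclass : ∀ K ∈ H, K = {v, a, a'} ∨ K = {v, b, b'} ∨ K = {v, c, c'} ∨ K = {a, b, c} ∨
      K = {a, b', c'} ∨ K = {a', b, c'} ∨ K = {a', b', c} := by
    intro K hK
    by_cases hvK : v ∈ K
    · obtain h | h | h := M hK hT
      · exact Or.inl (hlin _ hK _ hA v a hav.symm hvK h (by simp) (by simp))
      · exact Or.inr (Or.inl (hlin _ hK _ hB v b hbv.symm hvK h (by simp) (by simp)))
      · exact Or.inr (Or.inr (Or.inl (hlin _ hK _ hD v c hcv.symm hvK h (by simp) (by simp))))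
    · have mA := (M hK hA).resolve_left hvK
      have mB := (M hK hB).resolve_left hvK
      have mD := (M hK hD).resolve_left hvK
      have l1 : a ∈ K → b ∈ K → K = {a, b, c} := fun h h' =>
        hlin _ hK _ hT a b hab h h' (by simp) (by simp)
      have l2 : a ∈ K → c ∈ K → K = {a, b, c} := fun h h' =>
        hlin _ hK _ hT a c hac h h' (by simp) (by simp)
      have l3 : b ∈ K → c ∈ K → K = {a, b, c} := fun h h' =>
        hlin _ hK _ hT b c hbc h h' (by simp) (by simp)
      have hc := h3 K hK
      have i4 : ∀ {p1 p2 p3 p4 p5 p6 p7 : Prop}, p4 → p1 ∨ p2 ∨ p3 ∨ p4 ∨ p5 ∨ p6 ∨ p7 :=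
        fun h => Or.inr (Or.inr (Or.inr (Or.inl h)))
      have i5 : ∀ {p1 p2 p3 p4 p5 p6 p7 : Prop}, p5 → p1 ∨ p2 ∨ p3 ∨ p4 ∨ p5 ∨ p6 ∨ p7 :=
        fun h => Or.inr (Or.inr (Or.inr (Or.inr (Or.inl h))))
      have i6 : ∀ {p1 p2 p3 p4 p5 p6 p7 : Prop}, p6 → p1 ∨ p2 ∨ p3 ∨ p4 ∨ p5 ∨ p6 ∨ p7 :=
        fun h => Or.inr (Or.inr (Or.inr (Or.inr (Or.inr (Or.inl h)))))
      have i7 : ∀ {p1 p2 p3 p4 p5 p6 p7 : Prop}, p7 → p1 ∨ p2 ∨ p3 ∨ p4 ∨ p5 ∨ p6 ∨ p7 :=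
        fun h => Or.inr (Or.inr (Or.inr (Or.inr (Or.inr (Or.inr h)))))
      have mT := M hK hT
      by_cases h1 : a ∈ K
      · by_cases h2 : b ∈ K
        · exact i4 (l1 h1 h2)
        · by_cases h3 : c ∈ K
          · exact i4 (l2 h1 h3)
          · exact i5 (eq_triple hc h1 (mB.resolve_left h2) (mD.resolve_left h3) hab' hac' hb'c')
      · by_cases h2 : b ∈ K
        · by_cases h3 : c ∈ K
          · exact i4 (l3 h2 h3)
          · exact i6 (eq_triple hc (mA.resolve_left h1) h2 (mD.resolve_left h3) ha'b ha'c' hbc')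
        · have h3 : c ∈ K := by tauto
          exact i7 (eq_triple hc (mA.resolve_left h1) (mB.resolve_left h2) h3 ha'b' ha'c hb'c)
  have hU : ∀ K ∈ H, ∀ x ∈ K, x ∈ H.biUnion id := fun K hK x hx =>
    mem_biUnion.2 ⟨K, hK, hx⟩
  have hvU := hU _ hA v (by simp)
  have haU := hU _ hA a (by simp)
  have haU' := hU _ hA a' (by simp)
  have hbU := hU _ hB b (by simp)
  have hbU' := hU _ hB b' (by simp)
  have hcU := hU _ hD c (by simp)
  have hcU' := hU _ hD c' (by simp)
  have sub4 : ∀ {x y z w}, x ∈ H.biUnion id → y ∈ H.biUnion id → z ∈ H.biUnion id →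
      w ∈ H.biUnion id → ({x, y, z, w} : Finset ℕ) ⊆ H.biUnion id := by
    intro x y z w hx hy hz hw t ht
    simp only [mem_insert, mem_singleton] at ht
    obtain rfl | rfl | rfl | rfl := ht <;> assumption
  by_cases hP : ({a, b', c'} : Finset ℕ) ∈ H
  swap
  · right
    -- The complement of the missing line ab'c' among the seven points; the next two cases use the
    -- complements of a'bc' and a'b'c.
    refine ⟨{v, a', b, c}, sub4 hvU haU' hbU hcU, ?_, ?_⟩
    · exact card_quadruple hav'.symm hbv.symm hcv.symm ha'b ha'c hbc
    · intro K hK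
      obtain rfl | rfl | rfl | rfl | rfl | rfl | rfl := hclass K hK
      · exact two_le_card_inter hav'.symm (by simp) (by simp) (by simp) (by simp)
      · exact two_le_card_inter hbv.symm (by simp) (by simp) (by simp) (by simp)
      · exact two_le_card_inter hcv.symm (by simp) (by simp) (by simp) (by simp)
      · exact two_le_card_inter hbc (by simp) (by simp) (by simp) (by simp)
      · exact absurd hK hP
      · exact two_le_card_inter ha'b (by simp) (by simp) (by simp) (by simp)
      · exact two_le_card_inter ha'c (by simp) (by simp) (by simp) (by simp)
  by_cases hQ : ({a', b, c'} : Finset ℕ) ∈ H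
  swap
  · right
    refine ⟨{v, a, b', c}, sub4 hvU haU hbU' hcU, ?_, ?_⟩
    · exact card_quadruple hav.symm hbv'.symm hcv.symm hab' hac hb'c
    · intro K hK
      obtain rfl | rfl | rfl | rfl | rfl | rfl | rfl := hclass K hK
      · exact two_le_card_inter hav.symm (by simp) (by simp) (by simp) (by simp)
      · exact two_le_card_inter hbv'.symm (by simp) (by simp) (by simp) (by simp)
      · exact two_le_card_inter hcv.symm (by simp) (by simp) (by simp) (by simp)
      · exact two_le_card_inter hac (by simp) (by simp) (by simp) (by simp)
      · exact two_le_card_inter hab' (by simp) (by simp) (by simp) (by simp)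
      · exact absurd hK hQ
      · exact two_le_card_inter hb'c (by simp) (by simp) (by simp) (by simp)
  by_cases hR : ({a', b', c} : Finset ℕ) ∈ H
  swap
  · right
    refine ⟨{v, a, b, c'}, sub4 hvU haU hbU hcU', ?_, ?_⟩
    · exact card_quadruple hav.symm hbv.symm hcv'.symm hab hac' hbc'
    · intro K hK
      obtain rfl | rfl | rfl | rfl | rfl | rfl | rfl := hclass K hK
      · exact two_le_card_inter hav.symm (by simp) (by simp) (by simp) (by simp)
      · exact two_le_card_inter hbv.symm (by simp) (by simp) (by simp) (by simp)
      · exact two_le_card_inter hcv'.symm (by simp) (by simp) (by simp) (by simp)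
      · exact two_le_card_inter hab (by simp) (by simp) (by simp) (by simp)
      · exact two_le_card_inter hac' (by simp) (by simp) (by simp) (by simp)
      · exact two_le_card_inter hbc' (by simp) (by simp) (by simp) (by simp)
      · exact absurd hK hR
  left
  refine exists_fano_map ?_ hA hB hD hT hP hQ hR
  simp only [List.nodup_cons, List.mem_cons, List.not_mem_nil, List.nodup_nil, or_false, not_or,
    not_false_eq_true, and_true]
  exact ⟨⟨hav.symm, hbv.symm, hav'.symm, hcv.symm, hcv'.symm, hbv'.symm⟩,
    ⟨hab, haa, hac, hac', hab'⟩, ⟨ha'b.symm, hbc, hbc', hbb⟩, ⟨ha'c, ha'c', ha'b'⟩,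
    ⟨hcc, hb'c.symm⟩, hb'c'.symm⟩

end Structure
end Diversity

/-! ### Intersecting 3-graphs without a 2-cover: two edges sharing a pair -/

namespace Diversity
open Finset

theorem not_four_mem {E : Finset ℕ} (h : E.card = 3) {x y z w : ℕ} (hx : x ∈ E) (hy : y ∈ E)
    (hz : z ∈ E) (hw : w ∈ E)
    (hxy : x ≠ y := by first | assumption | (symm; assumption))
    (hxz : x ≠ z := by first | assumption | (symm; assumption))
    (hxw : x ≠ w := by first | assumption | (symm; assumption))
    (hyz : y ≠ z := by first | assumption | (symm; assumption))
    (hyw : y ≠ w := by first | assumption | (symm; assumption))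
    (hzw : z ≠ w := by first | assumption | (symm; assumption)) : False := by
  have h1 : ({x, y, z, w} : Finset ℕ) ⊆ E := by
    intro u hu
    simp only [mem_insert, mem_singleton] at hu
    obtain rfl | rfl | rfl | rfl := hu <;> assumption
  have := card_le_card h1
  rw [card_quadruple hxy hxz hxw hyz hyw hzw, h] at this
  omega

theorem triple_mem {H : Finset (Finset ℕ)} {E : Finset ℕ} (hE : E ∈ H) (h : E.card = 3)
    {x y z : ℕ} (hx : x ∈ E) (hy : y ∈ E) (hz : z ∈ E)
    (hxy : x ≠ y := by first | assumption | (symm; assumption))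
    (hxz : x ≠ z := by first | assumption | (symm; assumption))
    (hyz : y ≠ z := by first | assumption | (symm; assumption)) : {x, y, z} ∈ H :=
  eq_triple h hx hy hz hxy hxz hyz ▸ hE

theorem quadruple_subset {U : Finset ℕ} {x y z w : ℕ} (hx : x ∈ U) (hy : y ∈ U) (hz : z ∈ U)
    (hw : w ∈ U) : ({x, y, z, w} : Finset ℕ) ⊆ U := by
  intro t ht
  simp only [mem_insert, mem_singleton] at ht
  obtain rfl | rfl | rfl | rfl := ht <;> assumption

theorem two_le_card_inter_quadruple {K : Finset ℕ} {x y z w : ℕ} (hxy : x ≠ y) (hxz : x ≠ z)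
    (hxw : x ≠ w) (hyz : y ≠ z) (hyw : y ≠ w) (hzw : z ≠ w)
    (h : (x ∈ K ∧ y ∈ K) ∨ (x ∈ K ∧ z ∈ K) ∨ (x ∈ K ∧ w ∈ K) ∨ (y ∈ K ∧ z ∈ K) ∨
      (y ∈ K ∧ w ∈ K) ∨ (z ∈ K ∧ w ∈ K)) : 2 ≤ (K ∩ {x, y, z, w}).card := by
  obtain ⟨h, h'⟩ | ⟨h, h'⟩ | ⟨h, h'⟩ | ⟨h, h'⟩ | ⟨h, h'⟩ | ⟨h, h'⟩ := h
  · exact two_le_card_inter hxy h h' (by simp) (by simp)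
  · exact two_le_card_inter hxz h h' (by simp) (by simp)
  · exact two_le_card_inter hxw h h' (by simp) (by simp)
  · exact two_le_card_inter hyz h h' (by simp) (by simp)
  · exact two_le_card_inter hyw h h' (by simp) (by simp)
  · exact two_le_card_inter hzw h h' (by simp) (by simp)

section Structure

variable {H : Finset (Finset ℕ)} (hint : ∀ A ∈ H, ∀ B ∈ H, (A ∩ B).Nonempty)
  (h3 : ∀ E ∈ H, E.card = 3) (hcov : ∀ x y, ∃ E ∈ H, x ∉ E ∧ y ∉ E)

-- Edges avoiding the pairs x, a and x, z exist and are forced to be yzt and vya, since any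
-- alternative would have four points. With these two in H, an edge meeting {x, y, z, a} only once
-- would also need four points.
include hint h3 hcov in
theorem exists_quadruple_of_five {x y a b z v t : ℕ} (hxy : x ≠ y) (hxa : x ≠ a) (hxb : x ≠ b)
    (hxz : x ≠ z) (hxv : x ≠ v) (hxt : x ≠ t) (hya : y ≠ a) (hyb : y ≠ b) (hyz : y ≠ z)
    (hyv : y ≠ v) (hyt : y ≠ t) (hab : a ≠ b) (haz : a ≠ z) (hav : a ≠ v) (hat : a ≠ t)
    (hbv : b ≠ v) (hbt : b ≠ t) (hzt : z ≠ t) (hvt : v ≠ t)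
    (h1 : {x, y, a} ∈ H) (h2 : {x, y, b} ∈ H) (h4 : {a, b, z} ∈ H) (h5 : {x, z, v} ∈ H)
    (h6 : {x, a, t} ∈ H) :
    ∃ X ⊆ H.biUnion id, X.card = 4 ∧ ∀ K ∈ H, 2 ≤ (K ∩ X).card := by
  have M : ∀ {E : Finset ℕ} {x y z : ℕ}, E ∈ H → {x, y, z} ∈ H → x ∈ E ∨ y ∈ E ∨ z ∈ E :=
    fun h1 h2 => mem_of_triple_mem hint h1 h2
  have h7 : {y, z, t} ∈ H := by
    obtain ⟨E, hE, hx, ha⟩ := hcov x a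
    have m1 : y ∈ E := ((M hE h1).resolve_left hx).resolve_right ha
    have m2 : t ∈ E := ((M hE h6).resolve_left hx).resolve_left ha
    by_cases m3 : z ∈ E
    · exact triple_mem hE (h3 E hE) m1 m3 m2
    · have m4 : b ∈ E := ((M hE h4).resolve_left ha).resolve_right m3
      have m5 : v ∈ E := ((M hE h5).resolve_left hx).resolve_left m3
      exact (not_four_mem (h3 E hE) m1 m2 m4 m5).elim
  have h8 : {v, y, a} ∈ H := by
    obtain ⟨E, hE, hx, hz⟩ := hcov x z
    have m1 : v ∈ E := ((M hE h5).resolve_left hx).resolve_left hz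
    by_cases m2 : y ∈ E
    · by_cases m3 : a ∈ E
      · exact triple_mem hE (h3 E hE) m1 m2 m3
      · have m4 : t ∈ E := ((M hE h6).resolve_left hx).resolve_left m3
        have m5 : b ∈ E := ((M hE h4).resolve_left m3).resolve_right hz
        exact (not_four_mem (h3 E hE) m1 m2 m4 m5).elim
    · have m3 : a ∈ E := ((M hE h1).resolve_left hx).resolve_left m2
      have m4 : b ∈ E := ((M hE h2).resolve_left hx).resolve_left m2
      have m5 : t ∈ E := ((M hE h7).resolve_left m2).resolve_left hz
      exact (not_four_mem (h3 E hE) m1 m3 m4 m5).elim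
  refine ⟨{x, y, z, a}, quadruple_subset (mem_biUnion.2 ⟨_, h1, by simp⟩)
    (mem_biUnion.2 ⟨_, h1, by simp⟩) (mem_biUnion.2 ⟨_, h4, by simp⟩)
    (mem_biUnion.2 ⟨_, h1, by simp⟩),
    card_quadruple hxy hxz hxa hyz hya haz.symm, fun K hK => ?_⟩
  refine two_le_card_inter_quadruple hxy hxz hxa hyz hya haz.symm ?_
  by_contra hcon
  simp only [not_or, not_and] at hcon
  obtain ⟨c1, c2, c3, c4, c5, c6⟩ := hcon
  obtain hx | hy | ha := M hK h1
  · have b1 := ((M hK h4).resolve_left (c3 hx)).resolve_right (c2 hx)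
    have b2 := ((M hK h7).resolve_left (c1 hx)).resolve_left (c2 hx)
    have b3 := (M hK h8).resolve_right fun h => h.elim (c1 hx) (c3 hx)
    exact not_four_mem (h3 K hK) hx b1 b2 b3
  · have hx : x ∉ K := fun h => c1 h hy
    have b1 := ((M hK h4).resolve_left (c5 hy)).resolve_right (c4 hy)
    have b2 := ((M hK h6).resolve_left hx).resolve_left (c5 hy)
    have b3 := ((M hK h5).resolve_left hx).resolve_left (c4 hy)
    exact not_four_mem (h3 K hK) hy b1 b2 b3
  · have hx : x ∉ K := fun h => c3 h ha
    have hy : y ∉ K := fun h => c5 h ha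
    have hz : z ∉ K := fun h => c6 h ha
    have b1 := ((M hK h2).resolve_left hx).resolve_left hy
    have b2 := ((M hK h7).resolve_left hy).resolve_left hz
    have b3 := ((M hK h5).resolve_left hx).resolve_left hz
    exact not_four_mem (h3 K hK) ha b1 b2 b3

-- An edge with a vertex t outside the six points forces xat or xbt into H, which reduces to the
-- five-edge configuration, possibly with a and b exchanged.
include hint h3 hcov in
theorem sextuple_or_quadruple_of_four {x y a b z v : ℕ} (hxy : x ≠ y) (hxa : x ≠ a)
    (hxb : x ≠ b) (hxz : x ≠ z) (hxv : x ≠ v) (hya : y ≠ a) (hyb : y ≠ b) (hyz : y ≠ z)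
    (hyv : y ≠ v) (hab : a ≠ b) (haz : a ≠ z) (hav : a ≠ v)
    (hbz : b ≠ z) (hbv : b ≠ v) (hzv : z ≠ v)
    (h1 : {x, y, a} ∈ H) (h2 : {x, y, b} ∈ H) (h4 : {a, b, z} ∈ H) (h5 : {x, z, v} ∈ H) :
    (∃ X ⊆ H.biUnion id, X.card = 6 ∧ ∀ K ∈ H, K ⊆ X) ∨
      ∃ X ⊆ H.biUnion id, X.card = 4 ∧ ∀ K ∈ H, 2 ≤ (K ∩ X).card := by
  have M : ∀ {E : Finset ℕ} {x y z : ℕ}, E ∈ H → {x, y, z} ∈ H → x ∈ E ∨ y ∈ E ∨ z ∈ E :=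
    fun h1 h2 => mem_of_triple_mem hint h1 h2
  by_cases hall : ∀ K ∈ H, K ⊆ ({x, y, a, b, z, v} : Finset ℕ)
  · left
    refine ⟨_, ?_, ?_, hall⟩
    · intro w hw
      simp only [mem_insert, mem_singleton] at hw
      obtain rfl | rfl | rfl | rfl | rfl | rfl := hw
      · exact mem_biUnion.2 ⟨_, h1, by simp⟩
      · exact mem_biUnion.2 ⟨_, h1, by simp⟩
      · exact mem_biUnion.2 ⟨_, h1, by simp⟩
      · exact mem_biUnion.2 ⟨_, h2, by simp⟩
      · exact mem_biUnion.2 ⟨_, h4, by simp⟩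
      · exact mem_biUnion.2 ⟨_, h5, by simp⟩
    · rw [card_insert_of_notMem (by simp [*]), card_insert_of_notMem (by simp [*]),
        card_quadruple hab haz hav hbz hbv hzv]
  right
  simp only [not_forall, not_subset] at hall
  obtain ⟨E, hE, t, htE, ht⟩ := hall
  simp only [mem_insert, mem_singleton, not_or] at ht
  obtain ⟨htx, hty, hta, htb, htz, htv⟩ : t ≠ x ∧ t ≠ y ∧ t ≠ a ∧ t ≠ b ∧ t ≠ z ∧ t ≠ v := ht
  have finA : {x, a, t} ∈ H → _ := fun h6 =>
    exists_quadruple_of_five hint h3 hcov hxy hxa hxb hxz hxv htx.symm hya hyb hyz hyv hty.symm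
      hab haz hav hta.symm hbv htb.symm htz.symm htv.symm h1 h2 h4 h5 h6
  have finB : {x, b, t} ∈ H → _ := fun h6 =>
    exists_quadruple_of_five hint h3 hcov hxy hxb hxa hxz hxv htx.symm hyb hya hyz hyv hty.symm
      hab.symm hbz hbv htb.symm hav hta.symm htz.symm htv.symm h2 h1
      (by rwa [Finset.insert_comm]) h5 h6
  by_cases hx : x ∈ E
  · obtain ha | hb | hz := M hE h4
    · exact finA (triple_mem hE (h3 E hE) hx ha htE)
    · exact finB (triple_mem hE (h3 E hE) hx hb htE)
    · exfalso
      have h6 : {x, z, t} ∈ H := triple_mem hE (h3 E hE) hx hz htE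
      obtain ⟨K, hK, hxK, hzK⟩ := hcov x z
      have m5 : v ∈ K := ((M hK h5).resolve_left hxK).resolve_left hzK
      have m6 : t ∈ K := ((M hK h6).resolve_left hxK).resolve_left hzK
      by_cases hy : y ∈ K
      · obtain ha | hb | hz := M hK h4
        · exact not_four_mem (h3 K hK) m5 m6 hy ha
        · exact not_four_mem (h3 K hK) m5 m6 hy hb
        · exact hzK hz
      · exact not_four_mem (h3 K hK) m5 m6 (((M hK h1).resolve_left hxK).resolve_left hy)
          (((M hK h2).resolve_left hxK).resolve_left hy)
  · have hz : z ∈ E := by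
      by_contra hz
      have hv : v ∈ E := ((M hE h5).resolve_left hx).resolve_left hz
      by_cases hy : y ∈ E
      · obtain ha | hb | hz' := M hE h4
        · exact not_four_mem (h3 E hE) htE hv hy ha
        · exact not_four_mem (h3 E hE) htE hv hy hb
        · exact hz hz'
      · exact not_four_mem (h3 E hE) htE hv (((M hE h1).resolve_left hx).resolve_left hy)
          (((M hE h2).resolve_left hx).resolve_left hy)
    have hy : y ∈ E := by
      by_contra hy
      exact not_four_mem (h3 E hE) htE hz (((M hE h1).resolve_left hx).resolve_left hy)
          (((M hE h2).resolve_left hx).resolve_left hy)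
    have h6 : {y, z, t} ∈ H := triple_mem hE (h3 E hE) hy hz htE
    obtain ⟨K, hK, hyK, hzK⟩ := hcov y z
    have m6 : t ∈ K := ((M hK h6).resolve_left hyK).resolve_left hzK
    by_cases hx : x ∈ K
    · obtain ha | hb | hz := M hK h4
      · exact finA (triple_mem hK (h3 K hK) hx ha m6)
      · exact finB (triple_mem hK (h3 K hK) hx hb m6)
      · exact absurd hz hzK
    · exact (not_four_mem (h3 K hK) m6 (((M hK h5).resolve_left hx).resolve_left hzK)
        (((M hK h1).resolve_left hx).resolve_left hyK)
        (((M hK h2).resolve_left hx).resolve_left hyK)).elim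

-- An edge avoiding x and y contains a and b, say abz. An edge meeting {x, y, a, b} only once must
-- do so in x or y, and it must contain z to meet abz; this produces the fourth edge xzv or yzv.
include hint h3 hcov in
theorem sextuple_or_quadruple_of_two {x y a b : ℕ} (hxy : x ≠ y) (hxa : x ≠ a)
    (hxb : x ≠ b) (hya : y ≠ a) (hyb : y ≠ b) (hab : a ≠ b)
    (h1 : {x, y, a} ∈ H) (h2 : {x, y, b} ∈ H) :
    (∃ X ⊆ H.biUnion id, X.card = 6 ∧ ∀ K ∈ H, K ⊆ X) ∨
      ∃ X ⊆ H.biUnion id, X.card = 4 ∧ ∀ K ∈ H, 2 ≤ (K ∩ X).card := by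
  have M : ∀ {E : Finset ℕ} {x y z : ℕ}, E ∈ H → {x, y, z} ∈ H → x ∈ E ∨ y ∈ E ∨ z ∈ E :=
    fun h1 h2 => mem_of_triple_mem hint h1 h2
  obtain ⟨E, hE, hx, hy⟩ := hcov x y
  have ha : a ∈ E := ((M hE h1).resolve_left hx).resolve_left hy
  have hb : b ∈ E := ((M hE h2).resolve_left hx).resolve_left hy
  obtain ⟨z, hza, hzb, rfl⟩ := exists_third (h3 E hE) ha hb hab
  have hxz : x ≠ z := by rintro rfl; simp at hx
  have hyz : y ≠ z := by rintro rfl; simp at hy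
  by_cases hall : ∀ K ∈ H, 2 ≤ (K ∩ {x, y, a, b}).card
  · exact Or.inr ⟨_, quadruple_subset (mem_biUnion.2 ⟨_, h1, by simp⟩)
      (mem_biUnion.2 ⟨_, h1, by simp⟩) (mem_biUnion.2 ⟨_, h1, by simp⟩)
      (mem_biUnion.2 ⟨_, h2, by simp⟩), card_quadruple hxy hxa hxb hya hyb hab, hall⟩
  simp only [not_forall] at hall
  obtain ⟨K, hK, hcard⟩ := hall
  have hnot := mt (two_le_card_inter_quadruple hxy hxa hxb hya hyb hab) hcard
  simp only [not_or, not_and] at hnot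
  obtain ⟨c1, c2, c3, c4, c5, c6⟩ := hnot
  by_cases hxK : x ∈ K
  · have hyK : y ∉ K := c1 hxK
    have haK : a ∉ K := c2 hxK
    have hbK : b ∉ K := c3 hxK
    have hzK : z ∈ K := ((M hK hE).resolve_left haK).resolve_left hbK
    obtain ⟨v, hvx, hvz, rfl⟩ := exists_third (h3 K hK) hxK hzK hxz
    simp only [mem_insert, mem_singleton, not_or] at hyK haK hbK
    exact sextuple_or_quadruple_of_four hint h3 hcov hxy hxa hxb hxz hvx.symm hya hyb hyz
      hyK.2.2 hab hza.symm haK.2.2 hzb.symm hbK.2.2 hvz.symm h1 h2 hE hK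
  · have hyK : y ∈ K := by
      by_contra hyK
      exact c6 (((M hK h1).resolve_left hxK).resolve_left hyK)
        (((M hK h2).resolve_left hxK).resolve_left hyK)
    have haK : a ∉ K := c4 hyK
    have hbK : b ∉ K := c5 hyK
    have hzK : z ∈ K := ((M hK hE).resolve_left haK).resolve_left hbK
    obtain ⟨v, hvy, hvz, rfl⟩ := exists_third (h3 K hK) hyK hzK hyz
    simp only [mem_insert, mem_singleton, not_or] at hxK haK hbK
    rw [Finset.insert_comm] at h1 h2
    exact sextuple_or_quadruple_of_four hint h3 hcov hxy.symm hya hyb hyz hvy.symm hxa hxb hxz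
      hxK.2.2 hab hza.symm haK.2.2 hzb.symm hbK.2.2 hvz.symm h1 h2 hE hK

include hint h3 hcov in
/-- An intersecting `3`-graph without a cover of size two contains a Fano plane, lives on six
vertices, or has a set of four vertices that meets every edge twice. -/
theorem fano_or_sextuple_or_quadruple :
    (∃ f : ℕ → ℕ, Set.InjOn f (Icc 1 7 : Finset ℕ) ∧ ∀ L ∈ fano, L.image f ∈ H) ∨
    (∃ X ⊆ H.biUnion id, X.card = 6 ∧ ∀ K ∈ H, K ⊆ X) ∨
      ∃ X ⊆ H.biUnion id, X.card = 4 ∧ ∀ K ∈ H, 2 ≤ (K ∩ X).card := by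
  by_cases hlin : ∀ K ∈ H, ∀ L ∈ H, ∀ x y, x ≠ y → x ∈ K → y ∈ K → x ∈ L → y ∈ L → K = L
  · obtain h | h := fano_or_of_linear hint h3 hcov hlin
    · exact Or.inl h
    · exact Or.inr (Or.inr h)
  · right
    simp only [not_forall] at hlin
    obtain ⟨K, hK, L, hL, x, y, hxy, hxK, hyK, hxL, hyL, hKL⟩ := hlin
    obtain ⟨a, hax, hay, rfl⟩ := exists_third (h3 K hK) hxK hyK hxy
    obtain ⟨b, hbx, hby, rfl⟩ := exists_third (h3 L hL) hxL hyL hxy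
    exact sextuple_or_quadruple_of_two hint h3 hcov hxy hax.symm hbx.symm hay.symm hby.symm
      (by rintro rfl; exact hKL rfl) hK hL

end Structure
end Diversity

/-! ### Heavy triples -/

namespace Diversity
open Finset

/-- The triples of vertices that are contained in many edges of `F`: so many that they meet every
edge of `F` if `F` is intersecting. -/
def heavySets (n r : ℕ) (F : Finset (Finset ℕ)) : Finset (Finset ℕ) :=
  ((Icc 1 n).powersetCard 3).filter fun K => r * n ^ (r - 3) < n * codegree F K

theorem subset_Icc_of_mem_heavySets {n r : ℕ} {F : Finset (Finset ℕ)} {K : Finset ℕ}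
    (hK : K ∈ heavySets n r F) : K ⊆ Icc 1 n :=
  (mem_powersetCard.1 (mem_filter.1 hK).1).1

theorem card_of_mem_heavySets {n r : ℕ} {F : Finset (Finset ℕ)} {K : Finset ℕ}
    (hK : K ∈ heavySets n r F) : K.card = 3 :=
  (mem_powersetCard.1 (mem_filter.1 hK).1).2

theorem lt_of_mem_heavySets {n r : ℕ} {F : Finset (Finset ℕ)} {K : Finset ℕ}
    (hK : K ∈ heavySets n r F) : r * n ^ (r - 3) < n * codegree F K :=
  (mem_filter.1 hK).2

section Intersecting

variable {n r : ℕ} {F : Finset (Finset ℕ)}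

theorem IsIntersectingFamily.card_eq (hF : IsIntersectingFamily n r F) {E : Finset ℕ}
    (hE : E ∈ F) : E.card = r :=
  (mem_powersetCard.1 (hF.1 hE)).2

theorem IsIntersectingFamily.subset_Icc (hF : IsIntersectingFamily n r F) {E : Finset ℕ}
    (hE : E ∈ F) : E ⊆ Icc 1 n :=
  (mem_powersetCard.1 (hF.1 hE)).1

theorem IsIntersectingFamily.mono (hF : IsIntersectingFamily n r F) {G : Finset (Finset ℕ)}
    (hG : G ⊆ F) : IsIntersectingFamily n r G :=
  ⟨hG.trans hF.1, fun A hA B hB => hF.2 A (hG hA) B (hG hB)⟩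

theorem mem_heavySets_of_lt (hF : F ⊆ (Icc 1 n).powersetCard r) {K : Finset ℕ}
    (hK : K.card = 3) (h : r * n ^ (r - 3) < n * codegree F K) : K ∈ heavySets n r F := by
  refine mem_filter.2 ⟨mem_powersetCard.2 ⟨?_, hK⟩, h⟩
  have : codegree F K ≠ 0 := by
    intro h0
    simp [h0] at h
  obtain ⟨E, hE⟩ := card_ne_zero.1 this
  rw [mem_filter] at hE
  exact hE.2.trans (mem_powersetCard.1 (hF hE.1)).1

/-- Each edge through K contains one of the |S| 4-sets K ∪ {y} with y in S. With S an edge or a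
heavy triple, this is the source of the threshold in `heavySets`. -/
theorem mul_codegree_le_of_forall_inter (hF : F ⊆ (Icc 1 n).powersetCard r)
    {K S : Finset ℕ} (hK : K.card = 3) (hKS : Disjoint S K)
    (h : ∀ E ∈ F, K ⊆ E → (E ∩ S).Nonempty) :
    n * codegree F K ≤ S.card * n ^ (r - 3) := by
  have h1 : codegree F K ≤ ∑ L ∈ S.image fun y => insert y K, codegree F L := by
    refine card_le_sum_codegree (filter_subset _ _) _ fun E hE => ?_
    rw [mem_filter] at hE
    obtain ⟨y, hy⟩ := h E hE.1 hE.2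
    rw [mem_inter] at hy
    exact ⟨_, mem_image_of_mem _ hy.2, insert_subset hy.1 hE.2⟩
  calc n * codegree F K ≤ ∑ L ∈ S.image fun y => insert y K, n * codegree F L := by
        rw [← mul_sum]; exact Nat.mul_le_mul_left _ h1
    _ ≤ (S.image fun y => insert y K).card • n ^ (r - 3) := by
        refine sum_le_card_nsmul _ _ _ fun L hL => ?_
        obtain ⟨y, hy, rfl⟩ := mem_image.1 hL
        refine mul_codegree_le_pow hF ?_
        rw [card_insert_of_notMem (disjoint_left.1 hKS hy), hK]
    _ ≤ _ := by
        rw [smul_eq_mul]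
        exact Nat.mul_le_mul_right _ card_image_le

theorem inter_heavySet_nonempty (hF : IsIntersectingFamily n r F)
    {E K : Finset ℕ} (hE : E ∈ F) (hK : K ∈ heavySets n r F) : (E ∩ K).Nonempty := by
  by_contra hne
  have := mul_codegree_le_of_forall_inter hF.1 (card_of_mem_heavySets hK)
    (disjoint_iff_inter_eq_empty.2 (not_nonempty_iff_eq_empty.1 hne))
    fun E' hE' _ => hF.2 E' hE' E hE
  rw [hF.card_eq hE] at this
  exact absurd (lt_of_mem_heavySets hK) (not_lt.2 this)

theorem heavySets_inter_nonempty (hr : 3 ≤ r) (hF : IsIntersectingFamily n r F)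
    {K L : Finset ℕ} (hK : K ∈ heavySets n r F) (hL : L ∈ heavySets n r F) :
    (K ∩ L).Nonempty := by
  by_contra hne
  have := mul_codegree_le_of_forall_inter hF.1 (card_of_mem_heavySets hK)
    (disjoint_iff_inter_eq_empty.2 (not_nonempty_iff_eq_empty.1 hne)).symm
    fun E hE _ => inter_heavySet_nonempty hF hE hL
  rw [card_of_mem_heavySets hL] at this
  have h1 := lt_of_mem_heavySets hK
  have h2 := Nat.mul_le_mul_right (n ^ (r - 3)) hr
  omega

/-- Only heavy triples can account for more than a lower-order number of edges. Read backwards, a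
large G forces many heavy triples in T. -/
theorem mul_card_le_of_covered (hr : 3 ≤ r) (hF : F ⊆ (Icc 1 n).powersetCard r)
    {G T : Finset (Finset ℕ)} (hG : G ⊆ F) (hT : ∀ K ∈ T, K.card = 3)
    (h : ∀ E ∈ G, ∃ K ∈ T, K ⊆ E) :
    n * G.card ≤ (T.filter fun K => K ∈ heavySets n r F).card * (n * (n - 3).choose (r - 3)) +
      T.card * (r * n ^ (r - 3)) := by
  calc n * G.card ≤ n * ∑ K ∈ T, codegree F K :=
        Nat.mul_le_mul_left _ (card_le_sum_codegree hG T h)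
    _ = ∑ K ∈ T, n * codegree F K := mul_sum _ _ _
    _ ≤ ∑ K ∈ T, ((if K ∈ heavySets n r F then n * (n - 3).choose (r - 3) else 0) +
          r * n ^ (r - 3)) := by
        refine sum_le_sum fun K hK => ?_
        split_ifs with hH
        · exact le_add_right (Nat.mul_le_mul_left _ (codegree_le_choose hr hF (hT K hK)))
        · rw [zero_add]
          by_contra hlt
          exact hH (mem_heavySets_of_lt hF (hT K hK) (not_le.1 hlt))
    _ = _ := by
        rw [sum_add_distrib, sum_const, smul_eq_mul, ← sum_filter, sum_const, smul_eq_mul]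

theorem exists_three_thirds {S : Finset (Finset ℕ)} (hS : ∀ K ∈ S, K.card = 3) {y a : ℕ}
    (hya : y ≠ a) (hmem : ∀ K ∈ S, y ∈ K ∧ a ∈ K) (hcard : 3 ≤ S.card) :
    ∃ W : Finset ℕ, W.card = 3 ∧ ∀ u ∈ W, {y, a, u} ∈ S := by
  have h1 : S ⊆ ((S.biUnion id).filter fun u => {y, a, u} ∈ S).image fun u => {y, a, u} := by
    intro K hK
    obtain ⟨u, -, -, hu⟩ := exists_third (hS K hK) (hmem K hK).1 (hmem K hK).2 hya
    rw [mem_image]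
    exact ⟨u, mem_filter.2 ⟨mem_biUnion.2 ⟨K, hK, hu ▸ (by simp)⟩, hu ▸ hK⟩, hu.symm⟩
  obtain ⟨W, hW, hW'⟩ := exists_subset_card_eq (hcard.trans ((card_le_card h1).trans card_image_le))
  exact ⟨W, hW', fun u hu => (mem_filter.1 (hW hu)).2⟩

/-- An edge through x that avoids y and a must meet three heavy triples yau, hence contains x and
all three points u: a fixed 4-set. -/
theorem mul_card_avoiding_le (hF : IsIntersectingFamily n r F)
    {S : Finset (Finset ℕ)} (hS : S ⊆ heavySets n r F) {x y a : ℕ} (hya : y ≠ a)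
    (hmem : ∀ K ∈ S, y ∈ K ∧ x ∉ K ∧ a ∈ K) (hcard : 3 ≤ S.card) :
    n * (F.filter fun E => x ∈ E ∧ y ∉ E ∧ a ∉ E).card ≤ n ^ (r - 3) := by
  obtain ⟨W, hW, hWS⟩ := exists_three_thirds (fun K hK => card_of_mem_heavySets (hS hK)) hya
    (fun K hK => ⟨(hmem K hK).1, (hmem K hK).2.2⟩) hcard
  have hx : x ∉ W := fun h => (hmem _ (hWS x h)).2.1 (by simp)
  refine le_trans (Nat.mul_le_mul_left _ ?_) (mul_codegree_le_pow hF.1 (K := insert x W) ?_)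
  · refine card_le_card fun E hE => ?_
    rw [mem_filter] at hE ⊢
    refine ⟨hE.1, insert_subset hE.2.1 fun u hu => ?_⟩
    obtain h | h | h := inter_triple_nonempty (inter_heavySet_nonempty hF hE.1 (hS (hWS u hu)))
    · exact absurd h hE.2.2.1
    · exact absurd h hE.2.2.2
    · exact h
  · rw [card_insert_of_notMem hx, hW]

/-- If some edge E₀ contains x but neither y nor a, every edge through y avoiding x contains a
triple yau with u in E₀. There are more than 4M such edges, so at least five of these triples are
heavy, and three suffice for `mul_card_avoiding_le`. -/
theorem mul_card_avoiding_le_of_common (hr : 3 ≤ r) (hF : IsIntersectingFamily n r F)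
    {x y a : ℕ} (hya : y ≠ a) (hxa : x ≠ a) (ha : ∀ E ∈ F, y ∈ E → x ∉ E → a ∈ E)
    (hy : 4 * (n * (n - 3).choose (r - 3)) + r ^ 3 * n ^ (r - 3) <
      n * (F.filter fun E => y ∈ E ∧ x ∉ E).card) :
    n * (F.filter fun E => x ∈ E ∧ y ∉ E ∧ a ∉ E).card ≤ n ^ (r - 3) := by
  obtain h0 | ⟨E₀, hE₀⟩ := (F.filter fun E => x ∈ E ∧ y ∉ E ∧ a ∉ E).eq_empty_or_nonempty
  · rw [h0]; simp
  rw [mem_filter] at hE₀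
  obtain ⟨hE₀, hx₀, hy₀, ha₀⟩ := hE₀
  set T := (E₀.erase x).image fun u => ({y, a, u} : Finset ℕ) with hT
  have hTmem : ∀ K ∈ T, y ∈ K ∧ x ∉ K ∧ a ∈ K ∧ K.card = 3 := by
    intro K hK
    obtain ⟨u, hu, rfl⟩ := mem_image.1 hK
    rw [mem_erase] at hu
    have huy : u ≠ y := by rintro rfl; exact hy₀ hu.2
    have hua : u ≠ a := by rintro rfl; exact ha₀ hu.2
    have hxy : x ≠ y := by rintro rfl; exact hy₀ hx₀
    refine ⟨by simp, ?_, by simp, card_eq_three.2 ⟨y, a, u, hya, huy.symm, hua.symm, rfl⟩⟩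
    simp [hxy, hxa, hu.1.symm]
  have h1 := mul_card_le_of_covered hr hF.1
    (filter_subset (fun E => y ∈ E ∧ x ∉ E) F) (fun K hK => (hTmem K hK).2.2.2) (T := T) <| by
      intro E hE
      rw [mem_filter] at hE
      obtain ⟨u, hu⟩ := hF.2 E hE.1 E₀ hE₀
      rw [mem_inter] at hu
      refine ⟨_, mem_image_of_mem _ (mem_erase.2 ⟨?_, hu.2⟩), ?_⟩
      · rintro rfl; exact hE.2.2 hu.1
      · intro w hw
        simp only [mem_insert, mem_singleton] at hw
        obtain rfl | rfl | rfl := hw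
        · exact hE.2.1
        · exact ha E hE.1 hE.2.1 hE.2.2
        · exact hu.1
  have hTc : T.card * (r * n ^ (r - 3)) ≤ r ^ 3 * n ^ (r - 3) := by
    have : T.card ≤ r := card_image_le.trans ((card_erase_le).trans (hF.card_eq hE₀).le)
    calc T.card * (r * n ^ (r - 3)) ≤ r * (r * n ^ (r - 3)) := Nat.mul_le_mul_right _ this
      _ = r ^ 2 * n ^ (r - 3) := by ring
      _ ≤ _ := Nat.mul_le_mul_right _ (Nat.pow_le_pow_right (by omega) (by norm_num))
  have h5 : 4 < (T.filter fun K => K ∈ heavySets n r F).card := by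
    refine lt_of_mul_lt_mul_right (a := n * (n - 3).choose (r - 3)) ?_ (Nat.zero_le _)
    omega
  refine mul_card_avoiding_le hF (S := T.filter fun K => K ∈ heavySets n r F) ?_ hya ?_
    (by omega)
  · exact fun K hK => (mem_filter.1 hK).2
  · intro K hK
    have := hTmem K (mem_filter.1 hK).1
    exact ⟨this.1, this.2.1, this.2.2.1⟩

/-- An edge through x avoiding y meets E₀ in some u, and then meets an edge `e u` through y that
avoids x and u in some v. So it contains one of at most r² triples xuv, and more than 4M edges need
five heavy ones. -/
theorem exists_five_heavy (hr : 3 ≤ r) (hF : IsIntersectingFamily n r F) {x y : ℕ}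
    (hxy : ∀ a, a ≠ y → ∃ E ∈ F, y ∈ E ∧ x ∉ E ∧ a ∉ E)
    (hx : 4 * (n * (n - 3).choose (r - 3)) + r ^ 3 * n ^ (r - 3) <
      n * (F.filter fun E => x ∈ E ∧ y ∉ E).card) :
    ∃ A ⊆ heavySets n r F, 5 ≤ A.card ∧ ∀ K ∈ A, x ∈ K ∧ y ∉ K := by
  -- Any vertex other than y would do here.
  obtain ⟨E₀, hE₀, hy₀, hx₀, -⟩ := hxy (y + 1) (by omega)
  choose! e he hye hxe hae using hxy
  set T := (E₀.erase y).biUnion fun u => ((e u).erase y).image fun v => ({x, u, v} : Finset ℕ)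
    with hT
  have hTmem : ∀ K ∈ T, x ∈ K ∧ y ∉ K ∧ K.card = 3 := by
    intro K hK
    obtain ⟨u, hu, hK⟩ := mem_biUnion.1 hK
    obtain ⟨v, hv, rfl⟩ := mem_image.1 hK
    rw [mem_erase] at hu hv
    have hux : u ≠ x := by rintro rfl; exact hx₀ hu.2
    have hvx : v ≠ x := by rintro rfl; exact hxe u hu.1 hv.2
    have huv : u ≠ v := by rintro rfl; exact hae u hu.1 hv.2
    have hxy : x ≠ y := by rintro rfl; exact hx₀ hy₀
    refine ⟨by simp, ?_, card_eq_three.2 ⟨x, u, v, hux.symm, hvx.symm, huv, rfl⟩⟩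
    simp [hxy.symm, hu.1.symm, hv.1.symm]
  have h1 := mul_card_le_of_covered hr hF.1
    (filter_subset (fun E => x ∈ E ∧ y ∉ E) F) (fun K hK => (hTmem K hK).2.2) (T := T) <| by
      intro E hE
      rw [mem_filter] at hE
      obtain ⟨u, hu⟩ := hF.2 E hE.1 E₀ hE₀
      rw [mem_inter] at hu
      have huy : u ≠ y := by rintro rfl; exact hE.2.2 hu.1
      obtain ⟨v, hv⟩ := hF.2 E hE.1 (e u) (he u huy)
      rw [mem_inter] at hv
      have hvy : v ≠ y := by rintro rfl; exact hE.2.2 hv.1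
      refine ⟨_, mem_biUnion.2 ⟨u, mem_erase.2 ⟨huy, hu.2⟩,
        mem_image_of_mem _ (mem_erase.2 ⟨hvy, hv.2⟩)⟩, ?_⟩
      intro w hw
      simp only [mem_insert, mem_singleton] at hw
      obtain rfl | rfl | rfl := hw
      · exact hE.2.1
      · exact hu.1
      · exact hv.1
  have hTc : T.card * (r * n ^ (r - 3)) ≤ r ^ 3 * n ^ (r - 3) := by
    have : T.card ≤ r * r := by
      calc T.card ≤ ∑ u ∈ E₀.erase y, (((e u).erase y).image fun v =>
            ({x, u, v} : Finset ℕ)).card := card_biUnion_le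
        _ ≤ (E₀.erase y).card • r := sum_le_card_nsmul _ _ _ fun u hu =>
            card_image_le.trans (card_erase_le.trans
              (hF.card_eq (he u (mem_erase.1 hu).1)).le)
        _ ≤ r * r := Nat.mul_le_mul_right _ (card_erase_le.trans (hF.card_eq hE₀).le)
    calc T.card * (r * n ^ (r - 3)) ≤ r * r * (r * n ^ (r - 3)) := Nat.mul_le_mul_right _ this
      _ = r ^ 3 * n ^ (r - 3) := by ring
  refine ⟨T.filter fun K => K ∈ heavySets n r F, fun K hK => (mem_filter.1 hK).2, ?_,
    fun K hK => ?_⟩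
  · refine lt_of_mul_lt_mul_right (a := n * (n - 3).choose (r - 3)) (b := 4) ?_ (Nat.zero_le _)
    omega
  · have := hTmem K (mem_filter.1 hK).1
    exact ⟨this.1, this.2.1⟩

/-- For a triple xpq of A, every member of B contains p or q, so one of them, a, lies in at least
three members of B. A member of A missing a would contain x and the three remaining points of those
triples, four points in all. So a lies in every member of A, and `mul_card_avoiding_le` applies on
both sides. -/
theorem exists_common_vertex_of_five_heavy (hr : 3 ≤ r) (hF : IsIntersectingFamily n r F)
    {x y : ℕ} {A B : Finset (Finset ℕ)} (hA : A ⊆ heavySets n r F) (hB : B ⊆ heavySets n r F)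
    (hAc : 5 ≤ A.card) (hBc : 5 ≤ B.card) (hAxy : ∀ K ∈ A, x ∈ K ∧ y ∉ K)
    (hBxy : ∀ K ∈ B, y ∈ K ∧ x ∉ K) :
    ∃ a, a ≠ x ∧ a ≠ y ∧
      n * (F.filter fun E => x ∈ E ∧ y ∉ E ∧ a ∉ E).card ≤ n ^ (r - 3) ∧
      n * (F.filter fun E => y ∈ E ∧ x ∉ E ∧ a ∉ E).card ≤ n ^ (r - 3) := by
  obtain ⟨K, hK⟩ : A.Nonempty := card_pos.1 (by omega)
  obtain ⟨p, q, hpx, hqx, hpq, rfl⟩ :=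
    exists_other_two (card_of_mem_heavySets (hA hK)) (hAxy K hK).1
  have hy := (hAxy _ hK).2
  simp only [mem_insert, mem_singleton, not_or] at hy
  have hsplit : B.card ≤ (B.filter fun L => p ∈ L).card + (B.filter fun L => q ∈ L).card := by
    refine le_trans (card_le_card fun L hL => ?_) (card_union_le _ _)
    obtain h | h | h := inter_triple_nonempty (heavySets_inter_nonempty hr hF (hB hL) (hA hK))
    · exact absurd h (hBxy L hL).2
    · exact mem_union_left _ (mem_filter.2 ⟨hL, h⟩)
    · exact mem_union_right _ (mem_filter.2 ⟨hL, h⟩)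
  obtain ⟨a, hax, hay, ha⟩ : ∃ a, a ≠ x ∧ a ≠ y ∧ 3 ≤ (B.filter fun L => a ∈ L).card := by
    by_cases h : 3 ≤ (B.filter fun L => p ∈ L).card
    · exact ⟨p, hpx, Ne.symm hy.2.1, h⟩
    · exact ⟨q, hqx, Ne.symm hy.2.2, by omega⟩
  refine ⟨a, hax, hay, ?_, ?_⟩
  · refine mul_card_avoiding_le hF ((filter_subset _ _).trans hB) hay.symm (fun L hL => ?_) ha
    rw [mem_filter] at hL
    exact ⟨(hBxy L hL.1).1, (hBxy L hL.1).2, hL.2⟩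
  · refine mul_card_avoiding_le hF hA hax.symm (fun L hL => ?_) (by omega)
    refine ⟨(hAxy L hL).1, (hAxy L hL).2, ?_⟩
    by_contra haL
    obtain ⟨W, hW, hWB⟩ := exists_three_thirds (S := B.filter fun L => a ∈ L)
      (fun K hK => card_of_mem_heavySets (hB (mem_filter.1 hK).1)) hay.symm
      (fun K hK => ⟨(hBxy K (mem_filter.1 hK).1).1, (mem_filter.1 hK).2⟩) ha
    have hxW : x ∉ W := fun h => (hBxy _ (mem_filter.1 (hWB x h)).1).2 (by simp)
    have hsub : insert x W ⊆ L := by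
      refine insert_subset (hAxy L hL).1 fun u hu => ?_
      obtain h | h | h := inter_triple_nonempty
        (heavySets_inter_nonempty hr hF (hA hL) (hB (mem_filter.1 (hWB u hu)).1))
      · exact absurd h (hAxy L hL).2
      · exact absurd h haL
      · exact h
    have := card_le_card hsub
    rw [card_insert_of_notMem hxW, hW, card_of_mem_heavySets (hA hL)] at this
    omega

theorem exists_common_vertex (hr : 3 ≤ r) (hF : IsIntersectingFamily n r F) {x y : ℕ}
    (hx : 4 * (n * (n - 3).choose (r - 3)) + r ^ 3 * n ^ (r - 3) <
      n * (F.filter fun E => x ∈ E ∧ y ∉ E).card)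
    (hy : 4 * (n * (n - 3).choose (r - 3)) + r ^ 3 * n ^ (r - 3) <
      n * (F.filter fun E => y ∈ E ∧ x ∉ E).card) :
    ∃ a, a ≠ x ∧ a ≠ y ∧
      n * (F.filter fun E => x ∈ E ∧ y ∉ E ∧ a ∉ E).card ≤ n ^ (r - 3) ∧
      n * (F.filter fun E => y ∈ E ∧ x ∉ E ∧ a ∉ E).card ≤ n ^ (r - 3) := by
  have nonempty : ∀ x y, 4 * (n * (n - 3).choose (r - 3)) + r ^ 3 * n ^ (r - 3) <
      n * (F.filter fun E => x ∈ E ∧ y ∉ E).card → ∃ E ∈ F, x ∈ E ∧ y ∉ E := by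
    intro x y h
    have h0 : (F.filter fun E => x ∈ E ∧ y ∉ E).card ≠ 0 := by
      intro h0
      rw [h0] at h
      omega
    obtain ⟨E, hE⟩ := card_ne_zero.1 h0
    exact ⟨E, (mem_filter.1 hE).1, (mem_filter.1 hE).2⟩
  have none : ∀ x y a, (∀ E ∈ F, y ∈ E → x ∉ E → a ∈ E) →
      n * (F.filter fun E => y ∈ E ∧ x ∉ E ∧ a ∉ E).card ≤ n ^ (r - 3) := by
    intro x y a h
    rw [filter_eq_empty_iff.2]
    · simp
    · rintro E hE ⟨h1, h2, h3⟩
      exact h3 (h E hE h1 h2)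
  by_cases h1 : ∀ a, a ≠ y → ∃ E ∈ F, y ∈ E ∧ x ∉ E ∧ a ∉ E
  · by_cases h2 : ∀ a, a ≠ x → ∃ E ∈ F, x ∈ E ∧ y ∉ E ∧ a ∉ E
    · obtain ⟨A, hA, hAc, hAxy⟩ := exists_five_heavy hr hF h1 hx
      obtain ⟨B, hB, hBc, hBxy⟩ := exists_five_heavy hr hF h2 hy
      exact exists_common_vertex_of_five_heavy hr hF hA hB hAc hBc hAxy hBxy
    · simp only [not_forall, not_exists, not_and, not_not] at h2
      obtain ⟨a, hax, ha⟩ := h2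
      have hay : a ≠ y := by
        rintro rfl
        obtain ⟨E, hE, h1, h2⟩ := nonempty _ _ hx
        exact h2 (ha E hE h1 h2)
      exact ⟨a, hax, hay, none _ _ _ ha,
        mul_card_avoiding_le_of_common hr hF hax.symm hay.symm ha hx⟩
  · simp only [not_forall, not_exists, not_and, not_not] at h1
    obtain ⟨a, hay, ha⟩ := h1
    have hax : a ≠ x := by
      rintro rfl
      obtain ⟨E, hE, h1, h2⟩ := nonempty _ _ hy
      exact h2 (ha E hE h1 h2)
    exact ⟨a, hax, hay, mul_card_avoiding_le_of_common hr hF hay.symm hax.symm ha hy,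
      none _ _ _ ha⟩

end Intersecting
end Diversity

/-! ### Upper bounds on the diversity -/

namespace Diversity
open Finset

section Bounds

variable {n r : ℕ} {F : Finset (Finset ℕ)}

theorem diversity_two_nonpos_of_cover {x y : ℕ} (hx : x ∈ Icc 1 n) (hy : y ∈ Icc 1 n)
    (hcov : ∀ E ∈ F, x ∈ E ∨ y ∈ E) : diversity n 2 F ≤ 0 := by
  have h1 : F.card ≤ degree F x + degree F y := by
    refine (card_le_card fun E hE => ?_).trans (card_union_le _ _)
    rw [mem_union, mem_filter, mem_filter]
    exact (hcov E hE).imp (And.intro hE) (And.intro hE)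
  have h2 := degree_le_maxDegree (F := F) hx
  have h3 := degree_le_maxDegree (F := F) hy
  have h4 : (F.card : ℝ) ≤ 2 * maxDegree n F := by
    exact_mod_cast (show F.card ≤ 2 * maxDegree n F by omega)
  simp only [diversity]
  linarith

/-- If the bound failed, each of x and y would lie in more than 4M edges avoiding the other, so
`exists_common_vertex` gives a vertex a. At C = 3/2, averaging over {x, y, a} leaves positive weight
only on edges meeting it once, and these are few since the edges meeting it in a alone do not exist.
-/
theorem mul_diversity_le_of_cover (hr : 3 ≤ r) (hF : IsIntersectingFamily n r F) {x y : ℕ}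
    (hx : x ∈ Icc 1 n) (hy : y ∈ Icc 1 n) (hxy : x ≠ y) (hcov : ∀ E ∈ F, x ∈ E ∨ y ∈ E) :
    n * diversity n (3 / 2) F ≤
      9 / 4 * (n * (n - 3).choose (r - 3)) + r ^ 3 * (n : ℝ) ^ (r - 3) := by
  by_contra! hlt
  set p := (F.filter fun E => x ∈ E ∧ y ∉ E).card with hp
  set q := (F.filter fun E => y ∈ E ∧ x ∉ E).card with hq
  set s := (F.filter fun E => x ∈ E ∧ y ∈ E).card with hs
  have dx : degree F x = s + p := by
    rw [degree, hs, hp, ← filter_filter, ← filter_filter]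
    exact (card_filter_add_card_filter_not _).symm
  have dy : degree F y = s + q := by
    rw [degree, hs, hq, ← card_filter_add_card_filter_not (fun E => x ∈ E), filter_filter,
      filter_filter]
    congr 2
    exact filter_congr fun E _ => and_comm
  have hFc : F.card = s + p + q := by
    rw [← card_filter_add_card_filter_not (s := F) (fun E => x ∈ E), ← dx, degree]
    congr 2
    refine filter_congr fun E hE => ⟨fun h => ⟨(hcov E hE).resolve_left h, h⟩, fun h => h.2⟩
  have mx : ((s + p : ℕ) : ℝ) ≤ maxDegree n F := by
    exact_mod_cast dx ▸ degree_le_maxDegree (F := F) hx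
  have my : ((s + q : ℕ) : ℝ) ≤ maxDegree n F := by
    exact_mod_cast dy ▸ degree_le_maxDegree (F := F) hy
  have hd : diversity n (3 / 2) F = ((s + p + q : ℕ) : ℝ) - 3 / 2 * maxDegree n F := by
    rw [diversity, hFc]
  push_cast at mx my hd
  have hs0 : (0 : ℝ) ≤ s := Nat.cast_nonneg _
  have hn0 : (0 : ℝ) ≤ n := Nat.cast_nonneg _
  have hM0 : (0 : ℝ) ≤ n * (n - 3).choose (r - 3) := by positivity
  have hP0 : (0 : ℝ) ≤ (n : ℝ) ^ (r - 3) := by positivity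
  have hr1 : (1 : ℝ) ≤ (r : ℝ) ^ 3 := one_le_pow₀ (by exact_mod_cast (by omega : 1 ≤ r))
  have hPr : (n : ℝ) ^ (r - 3) ≤ r ^ 3 * (n : ℝ) ^ (r - 3) := le_mul_of_one_le_left hP0 hr1
  -- One copy of Δ ≥ s + p and two copies of Δ ≥ s + q. As d > (9/4)M, this gives p > (9/2)M, above
  -- the required 4M.
  have hpd : 2 * diversity n (3 / 2) F ≤ p := by linarith
  have hqd : 2 * diversity n (3 / 2) F ≤ q := by linarith
  have hnp := mul_le_mul_of_nonneg_left hpd hn0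
  have hnq := mul_le_mul_of_nonneg_left hqd hn0
  obtain ⟨a, hax, hay, ha1, ha2⟩ := exists_common_vertex hr hF (x := x) (y := y)
    (by rw [← hp]; rify; linarith) (by rw [← hq]; rify; linarith)
  rify at ha1 ha2
  -- A vertex outside [n] lies in no edge, so avoiding it would be no restriction and p itself would
  -- be small.
  have haI : a ∈ Icc 1 n := by
    by_contra haI
    have : (F.filter fun E => x ∈ E ∧ y ∉ E ∧ a ∉ E) = F.filter fun E => x ∈ E ∧ y ∉ E :=
      filter_congr fun E hE =>
        ⟨fun h => ⟨h.1, h.2.1⟩, fun h => ⟨h.1, h.2, fun h' => haI (hF.subset_Icc hE h')⟩⟩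
    rw [this, ← hp] at ha1
    linarith
  have hX : ({x, y, a} : Finset ℕ) ⊆ Icc 1 n := by
    intro w hw
    simp only [mem_insert, mem_singleton] at hw
    obtain rfl | rfl | rfl := hw <;> assumption
  have hXc : ({x, y, a} : Finset ℕ).card = 3 :=
    card_eq_three.2 ⟨x, y, a, hxy, hax.symm, hay.symm, rfl⟩
  have hle : diversity n (3 / 2) F ≤
      ∑ E ∈ F, ((if x ∈ E ∧ y ∉ E ∧ a ∉ E then (1 / 2 : ℝ) else 0) +
        if y ∈ E ∧ x ∉ E ∧ a ∉ E then (1 / 2 : ℝ) else 0) := by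
    refine (diversity_le_sum (by norm_num) hX (by simp) F).trans (sum_le_sum fun E hE => ?_)
    rw [hXc]
    have two : 2 ≤ (E ∩ {x, y, a}).card →
        1 - 3 / 2 * (((E ∩ {x, y, a}).card : ℝ) / (3 : ℕ)) ≤ 0 := by
      intro h
      have : (2 : ℝ) ≤ (E ∩ {x, y, a}).card := by exact_mod_cast h
      push_cast
      linarith
    have one : 1 ≤ (E ∩ {x, y, a}).card →
        1 - 3 / 2 * (((E ∩ {x, y, a}).card : ℝ) / (3 : ℕ)) ≤ 1 / 2 := by
      intro h
      have : (1 : ℝ) ≤ (E ∩ {x, y, a}).card := by exact_mod_cast h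
      push_cast
      linarith
    have hpos : (E ∩ {x, y, a}).Nonempty :=
      (hcov E hE).elim (fun h => ⟨x, by simp [h]⟩) fun h => ⟨y, by simp [h]⟩
    have one' := one hpos.card_pos
    by_cases h1 : x ∈ E <;> by_cases h2 : y ∈ E <;> by_cases h3 : a ∈ E
    · simpa [h1, h2, h3] using two (two_le_card_inter hxy h1 h2 (by simp) (by simp))
    · simpa [h1, h2, h3] using two (two_le_card_inter hxy h1 h2 (by simp) (by simp))
    · simpa [h1, h2, h3] using two (two_le_card_inter hax.symm h1 h3 (by simp) (by simp))
    · simp only [h1, h2, h3, not_true_eq_false, not_false_eq_true, and_true, and_false, if_true,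
        if_false, add_zero]
      exact one'
    · simpa [h1, h2, h3] using two (two_le_card_inter hay.symm h2 h3 (by simp) (by simp))
    · simp only [h1, h2, h3, not_true_eq_false, not_false_eq_true, and_true, and_false, if_true,
        if_false, zero_add]
      exact one'
    · exact absurd (hcov E hE) (by simp [h1, h2])
    · exact absurd (hcov E hE) (by simp [h1, h2])
  rw [sum_add_distrib, ← sum_filter, ← sum_filter, sum_const, sum_const, nsmul_eq_mul,
    nsmul_eq_mul] at hle
  have := mul_le_mul_of_nonneg_left hle hn0
  linarith

/-- Branching: an edge meets `e 0 0` in u, then `e u u` in v ≠ u, then `e u v` in w ≠ u, v. So every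
edge contains one of at most r³ triples, and the light ones among them carry few edges. -/
theorem mul_card_not_heavy_le (hr : 3 ≤ r) (hF : IsIntersectingFamily n r F)
    (hcov : ∀ x y, ∃ E ∈ F, x ∉ E ∧ y ∉ E) :
    n * (F.filter fun E => ∀ K ∈ heavySets n r F, ¬ K ⊆ E).card ≤ r ^ 4 * n ^ (r - 3) := by
  choose e he hex hey using hcov
  set T := (e 0 0).biUnion fun u => (e u u).biUnion fun v =>
    (e u v).image fun w => ({u, v, w} : Finset ℕ) with hT
  have hTmem : ∀ K ∈ T, K.card = 3 := by
    intro K hK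
    obtain ⟨u, hu, hK⟩ := mem_biUnion.1 hK
    obtain ⟨v, hv, hK⟩ := mem_biUnion.1 hK
    obtain ⟨w, hw, rfl⟩ := mem_image.1 hK
    refine card_eq_three.2 ⟨u, v, w, ?_, ?_, ?_, rfl⟩
    · rintro rfl; exact hex _ _ hv
    · rintro rfl; exact hex _ _ hw
    · rintro rfl; exact hey _ _ hw
  have hcover : ∀ E ∈ F, ∃ K ∈ T, K ⊆ E := by
    intro E hE
    obtain ⟨u, hu⟩ := hF.2 E hE _ (he 0 0)
    obtain ⟨v, hv⟩ := hF.2 E hE _ (he u u)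
    obtain ⟨w, hw⟩ := hF.2 E hE _ (he u v)
    rw [mem_inter] at hu hv hw
    refine ⟨{u, v, w}, mem_biUnion.2 ⟨u, hu.2, mem_biUnion.2 ⟨v, hv.2,
      mem_image_of_mem _ hw.2⟩⟩, ?_⟩
    intro t ht
    simp only [mem_insert, mem_singleton] at ht
    obtain rfl | rfl | rfl := ht
    · exact hu.1
    · exact hv.1
    · exact hw.1
  have hTc : T.card ≤ r * (r * r) := by
    refine card_biUnion_le.trans ((sum_le_card_nsmul _ _ (r * r) fun u _ => ?_).trans ?_)
    · refine card_biUnion_le.trans ((sum_le_card_nsmul _ _ r fun v _ => ?_).trans ?_)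
      · exact card_image_le.trans (hF.card_eq (he u v)).le
      · rw [hF.card_eq (he u u), smul_eq_mul]
    · rw [hF.card_eq (he 0 0), smul_eq_mul]
  have h1 := mul_card_le_of_covered hr hF.1 (T := T.filter fun K => K ∉ heavySets n r F)
    (filter_subset (fun E => ∀ K ∈ heavySets n r F, ¬ K ⊆ E) F)
    (fun K hK => hTmem K (mem_filter.1 hK).1) <| by
      intro E hE
      rw [mem_filter] at hE
      obtain ⟨K, hK, hKE⟩ := hcover E hE.1
      exact ⟨K, mem_filter.2 ⟨hK, fun h => hE.2 K h hKE⟩, hKE⟩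
  have h0 : ((T.filter fun K => K ∉ heavySets n r F).filter fun K => K ∈ heavySets n r F) = ∅ :=
    filter_eq_empty_iff.2 fun K hK => (mem_filter.1 hK).2
  rw [h0, card_empty, zero_mul, zero_add] at h1
  refine h1.trans ?_
  calc (T.filter fun K => K ∉ heavySets n r F).card * (r * n ^ (r - 3))
      ≤ r * (r * r) * (r * n ^ (r - 3)) :=
        Nat.mul_le_mul_right _ ((card_filter_le _ _).trans hTc)
    _ = r ^ 4 * n ^ (r - 3) := by ring

/-- The weight of an edge is at most that of any heavy triple inside it, and at most 1 for the few
edges containing none. -/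
theorem mul_diversity_le_sum_heavySets (hr : 3 ≤ r) (hF : IsIntersectingFamily n r F)
    (hcov : ∀ x y, ∃ E ∈ F, x ∉ E ∧ y ∉ E) {C : ℝ} (hC : 0 ≤ C) {X : Finset ℕ}
    (hX : X ⊆ Icc 1 n) (hX' : X.Nonempty) :
    n * diversity n C F ≤ (∑ K ∈ heavySets n r F, max 0 (1 - C * ((K ∩ X).card / X.card))) *
      (n * (n - 3).choose (r - 3)) + r ^ 4 * (n : ℝ) ^ (r - 3) := by
  have hX0 : (0 : ℝ) < X.card := by exact_mod_cast hX'.card_pos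
  have hf0 : ∀ E : Finset ℕ, (0 : ℝ) ≤ C * ((E ∩ X).card / X.card) := fun E => by positivity
  set H := heavySets n r F with hH
  have h1 : diversity n C F ≤ ∑ E ∈ F, ((if ∀ K ∈ H, ¬ K ⊆ E then (1 : ℝ) else 0) +
      ∑ K ∈ H, if K ⊆ E then max 0 (1 - C * ((K ∩ X).card / X.card)) else 0) := by
    refine (diversity_le_sum hC hX hX' F).trans (sum_le_sum fun E _ => ?_)
    have hs : ∀ K ∈ H, (0 : ℝ) ≤
        if K ⊆ E then max 0 (1 - C * ((K ∩ X).card / X.card)) else 0 := by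
      intro K _
      split_ifs
      · exact le_max_left _ _
      · exact le_rfl
    split_ifs with h
    · have := sum_nonneg hs
      have := hf0 E
      linarith
    · simp only [not_forall, not_not] at h
      obtain ⟨K, hK, hKE⟩ := h
      rw [zero_add]
      refine le_trans ?_ (single_le_sum hs hK)
      rw [if_pos hKE]
      refine le_trans ?_ (le_max_right _ _)
      have : ((K ∩ X).card : ℝ) ≤ (E ∩ X).card := by
        exact_mod_cast card_le_card (inter_subset_inter_right hKE)
      gcongr
  have h2 : ∑ E ∈ F, ∑ K ∈ H, (if K ⊆ E then max 0 (1 - C * ((K ∩ X).card / X.card)) else 0) =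
      ∑ K ∈ H, max 0 (1 - C * ((K ∩ X).card / X.card)) * codegree F K := by
    rw [sum_comm]
    refine sum_congr rfl fun K _ => ?_
    rw [← sum_filter, sum_const, nsmul_eq_mul, mul_comm]
    rfl
  rw [sum_add_distrib, h2, ← sum_filter, sum_const, nsmul_eq_mul, mul_one] at h1
  have h3 : (n * ((F.filter fun E => ∀ K ∈ H, ¬ K ⊆ E).card : ℝ)) ≤ r ^ 4 * (n : ℝ) ^ (r - 3) := by
    exact_mod_cast mul_card_not_heavy_le hr hF hcov
  have h4 : ∑ K ∈ H, max 0 (1 - C * ((K ∩ X).card / X.card)) * codegree F K ≤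
      (∑ K ∈ H, max 0 (1 - C * ((K ∩ X).card / X.card))) * (n - 3).choose (r - 3) := by
    rw [sum_mul]
    refine sum_le_sum fun K hK => mul_le_mul_of_nonneg_left ?_ (le_max_left _ _)
    exact_mod_cast codegree_le_choose hr hF.1 (card_of_mem_heavySets hK)
  have hn0 : (0 : ℝ) ≤ n := Nat.cast_nonneg _
  have h5 := mul_le_mul_of_nonneg_left (h1.trans (add_le_add_right h4 _)) hn0
  linarith

theorem mul_diversity_two_le_of_half (hr : 3 ≤ r) (hF : IsIntersectingFamily n r F)
    (hcov : ∀ x y, ∃ E ∈ F, x ∉ E ∧ y ∉ E) {X : Finset ℕ} (hX : X ⊆ Icc 1 n)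
    (hX' : X.Nonempty) (hhalf : ∀ K ∈ heavySets n r F, X.card ≤ 2 * (K ∩ X).card) :
    n * diversity n 2 F ≤ r ^ 4 * (n : ℝ) ^ (r - 3) := by
  have hX0 : (0 : ℝ) < X.card := by exact_mod_cast hX'.card_pos
  have h := mul_diversity_le_sum_heavySets hr hF hcov (C := 2) (by norm_num) hX hX'
  rwa [sum_eq_zero, zero_mul, zero_add] at h
  intro K hK
  rw [max_eq_left]
  have : (X.card : ℝ) ≤ 2 * (K ∩ X).card := by exact_mod_cast hhalf K hK
  rw [sub_nonpos, ← mul_div_assoc, one_le_div hX0]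
  exact this

/-- A triple with |K ∩ X|/|X| ≥ 1/2 has weight at most 1 - C/2, and once the ratio reaches 2/3 the
weight is nonpositive because C ≥ 3/2. So only the m triples below 2/3 count. -/
theorem mul_diversity_le_of_half (hr : 3 ≤ r) (hF : IsIntersectingFamily n r F)
    (hcov : ∀ x y, ∃ E ∈ F, x ∉ E ∧ y ∉ E) {C : ℝ} (hC : 3 / 2 ≤ C) (hC' : C ≤ 2)
    {X : Finset ℕ} (hX : X ⊆ Icc 1 n)
    (hX' : X.Nonempty) (hhalf : ∀ K ∈ heavySets n r F, X.card ≤ 2 * (K ∩ X).card) {m : ℕ}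
    (hm : ((heavySets n r F).filter fun K => 3 * (K ∩ X).card < 2 * X.card).card ≤ m) :
    n * diversity n C F ≤
      m * (1 - C / 2) * (n * (n - 3).choose (r - 3)) + r ^ 4 * (n : ℝ) ^ (r - 3) := by
  have hX0 : (0 : ℝ) < X.card := by exact_mod_cast hX'.card_pos
  refine (mul_diversity_le_sum_heavySets hr hF hcov (by linarith) hX hX').trans ?_
  gcongr
  calc ∑ K ∈ heavySets n r F, max 0 (1 - C * ((K ∩ X).card / X.card))
      ≤ ∑ K ∈ heavySets n r F, if 3 * (K ∩ X).card < 2 * X.card then 1 - C / 2 else 0 := by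
        refine sum_le_sum fun K hK => ?_
        have h1 : (X.card : ℝ) ≤ 2 * (K ∩ X).card := by exact_mod_cast hhalf K hK
        have h2 : (1 / 2 : ℝ) ≤ (K ∩ X).card / X.card := by
          rw [le_div_iff₀ hX0]; linarith
        split_ifs with h
        · exact max_le (by linarith) (by nlinarith)
        · have h3 : (2 * X.card : ℝ) ≤ 3 * (K ∩ X).card := by exact_mod_cast not_lt.1 h
          have h4 : (2 / 3 : ℝ) ≤ (K ∩ X).card / X.card := by
            rw [le_div_iff₀ hX0]; linarith
          exact max_le le_rfl (by nlinarith)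
    _ ≤ m * (1 - C / 2) := by
        rw [← sum_filter, sum_const, nsmul_eq_mul]
        exact mul_le_mul_of_nonneg_right (by exact_mod_cast hm) (by linarith)

end Bounds
end Diversity

/-! ### Small diversity, a heavy Fano plane, or ten heavy triples on six points -/

namespace Diversity
open Finset

/-- Triples with a two-point trace are determined by it. An edge E avoiding the trace {p, q} has at
most one point outside X, and a triple with this trace can meet E only there. -/
theorem card_le_six_of_quadruple {H : Finset (Finset ℕ)}
    (hint : ∀ A ∈ H, ∀ B ∈ H, (A ∩ B).Nonempty) (h3 : ∀ E ∈ H, E.card = 3)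
    (hcov : ∀ x y, ∃ E ∈ H, x ∉ E ∧ y ∉ E) {X : Finset ℕ} (hX : X.card = 4)
    (h2 : ∀ K ∈ H, 2 ≤ (K ∩ X).card) :
    (H.filter fun K => (K ∩ X).card = 2).card ≤ 6 := by
  have h6 : (X.powersetCard 2).card = 6 := by rw [card_powersetCard, hX]; rfl
  rw [← h6]
  refine card_le_card_of_injOn (fun K => K ∩ X) (fun K hK => ?_) fun K hK L hL hKL => ?_
  · rw [mem_coe, mem_filter] at hK
    exact mem_powersetCard.2 ⟨inter_subset_right, hK.2⟩
  · rw [mem_coe, mem_filter] at hK hL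
    dsimp only at hKL
    obtain ⟨p, q, hpq, hp⟩ := card_eq_two.1 hK.2
    obtain ⟨E, hE, hpE, hqE⟩ := hcov p q
    have hout : (E \ X).card ≤ 1 := by
      have := card_sdiff_add_card_inter E X
      have := h2 E hE
      have := h3 E hE
      omega
    have key : ∀ K ∈ H, K ∩ X = {p, q} → ∃ w ∈ E \ X, K = insert w {p, q} := by
      intro K hK hKX
      obtain ⟨w, hw⟩ := hint K hK E hE
      rw [mem_inter] at hw
      have hwX : w ∉ X := by
        intro hwX
        have : w ∈ K ∩ X := mem_inter.2 ⟨hw.1, hwX⟩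
        rw [hKX, mem_insert, mem_singleton] at this
        obtain rfl | rfl := this
        · exact hpE hw.2
        · exact hqE hw.2
      refine ⟨w, mem_sdiff.2 ⟨hw.2, hwX⟩, (eq_of_subset_of_card_le ?_ ?_).symm⟩
      · refine insert_subset hw.1 ?_
        rw [← hKX]
        exact inter_subset_left
      · rw [card_insert_of_notMem, card_pair hpq, h3 K hK]
        rw [← hKX]
        exact fun h => hwX (mem_inter.1 h).2
    obtain ⟨w, hw, hKw⟩ := key K hK.1 hp
    obtain ⟨w', hw', hLw⟩ := key L hL.1 (hKL ▸ hp)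
    rw [hKw, hLw, card_le_one.1 hout w hw w' hw']

/-- The 20 triples of X form ten complementary pairs, and an intersecting family takes at most one
from each. -/
theorem union_compl_eq_of_sextuple {H : Finset (Finset ℕ)}
    (hint : ∀ A ∈ H, ∀ B ∈ H, (A ∩ B).Nonempty) (h3 : ∀ E ∈ H, E.card = 3) {X : Finset ℕ}
    (hX : X.card = 6) (hHX : ∀ K ∈ H, K ⊆ X) :
    H.card ≤ 10 ∧ (10 ≤ H.card → ∀ T ⊆ X, T.card = 3 → T ∈ H ∨ X \ T ∈ H) := by
  have hinj : (H.image fun K => X \ K).card = H.card := by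
    refine card_image_of_injOn fun K hK L hL hKL => ?_
    have := congrArg (X \ ·) hKL
    simpa only [Finset.sdiff_sdiff_eq_self (hHX K hK), Finset.sdiff_sdiff_eq_self (hHX L hL)] using this
  have hdisj : Disjoint H (H.image fun K => X \ K) := by
    rw [disjoint_left]
    rintro L hL hL'
    obtain ⟨K, hK, rfl⟩ := mem_image.1 hL'
    obtain ⟨w, hw⟩ := hint K hK _ hL
    simp at hw
  have hsub : H ∪ H.image (fun K => X \ K) ⊆ X.powersetCard 3 := by
    refine union_subset (fun K hK => mem_powersetCard.2 ⟨hHX K hK, h3 K hK⟩) fun L hL => ?_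
    obtain ⟨K, hK, rfl⟩ := mem_image.1 hL
    refine mem_powersetCard.2 ⟨sdiff_subset, ?_⟩
    rw [card_sdiff_of_subset (hHX K hK), hX, h3 K hK]
  have h20 : (X.powersetCard 3).card = 20 := by rw [card_powersetCard, hX]; rfl
  have hc := card_union_of_disjoint hdisj
  rw [hinj] at hc
  refine ⟨?_, fun h10 T hT hT3 => ?_⟩
  · have := card_le_card hsub
    omega
  · have heq := eq_of_subset_of_card_le hsub (by omega)
    have hTm : T ∈ X.powersetCard 3 := mem_powersetCard.2 ⟨hT, hT3⟩
    rw [← heq, mem_union, mem_image] at hTm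
    obtain h | ⟨K, hK, rfl⟩ := hTm
    · exact Or.inl h
    · right
      rwa [Finset.sdiff_sdiff_eq_self (hHX K hK)]

/-- The covering points may coincide or lie outside [n], while the degree bounds need two distinct
vertices of [n]. -/
theorem exists_pair_of_cover {n : ℕ} (hn : 2 ≤ n) {F : Finset (Finset ℕ)}
    (hF : ∀ E ∈ F, E ⊆ Icc 1 n) {x y : ℕ} (h : ∀ E ∈ F, x ∈ E ∨ y ∈ E) :
    ∃ x' ∈ Icc 1 n, ∃ y' ∈ Icc 1 n, x' ≠ y' ∧ ∀ E ∈ F, x' ∈ E ∨ y' ∈ E := by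
  obtain ⟨S, h1, h2, h3⟩ := exists_subsuperset_card_eq
    (inter_subset_right : ({x, y} : Finset ℕ) ∩ Icc 1 n ⊆ Icc 1 n)
    ((card_le_card inter_subset_left).trans card_le_two) (by rwa [Nat.card_Icc, Nat.add_sub_cancel])
  obtain ⟨x', y', hxy, rfl⟩ := card_eq_two.1 h3
  refine ⟨x', h2 (by simp), y', h2 (by simp), hxy, fun E hE => ?_⟩
  obtain ⟨z, hzE, hz⟩ : ∃ z ∈ E, z ∈ ({x, y} : Finset ℕ) :=
    (h E hE).elim (fun h => ⟨x, h, by simp⟩) fun h => ⟨y, h, by simp⟩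
  have := h1 (mem_inter.2 ⟨hz, hF E hE hzE⟩)
  rw [mem_insert, mem_singleton] at this
  obtain rfl | rfl := this
  · exact Or.inl hzE
  · exact Or.inr hzE

section Dichotomy

variable {n r : ℕ} {F : Finset (Finset ℕ)}

theorem small_diversity_of_cover (hn : 2 ≤ n) (hr : 3 ≤ r) (hF : IsIntersectingFamily n r F)
    {x y : ℕ} (h : ∀ E ∈ F, x ∈ E ∨ y ∈ E) :
    diversity n 2 F ≤ 0 ∧ n * diversity n (3 / 2) F ≤
      9 / 4 * (n * (n - 3).choose (r - 3)) + r ^ 3 * (n : ℝ) ^ (r - 3) := by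
  obtain ⟨x', hx, y', hy, hxy, h'⟩ := exists_pair_of_cover hn (fun E hE => hF.subset_Icc hE) h
  exact ⟨diversity_two_nonpos_of_cover hx hy h', mul_diversity_le_of_cover hr hF hx hy hxy h'⟩

/-- Every edge containing a heavy triple is covered by x, y. Discarding the others costs only a
lower-order term and leaves a covered family. -/
theorem small_diversity_of_heavySets_cover (hn : 2 ≤ n) (hr : 3 ≤ r)
    (hF : IsIntersectingFamily n r F) (hcov : ∀ x y, ∃ E ∈ F, x ∉ E ∧ y ∉ E)
    {x y : ℕ} (h : ∀ K ∈ heavySets n r F, x ∈ K ∨ y ∈ K) :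
    n * diversity n 2 F ≤ 2 * r ^ 4 * (n : ℝ) ^ (r - 3) ∧ n * diversity n (3 / 2) F ≤
      9 / 4 * (n * (n - 3).choose (r - 3)) + 2 * r ^ 4 * (n : ℝ) ^ (r - 3) := by
  have hG : (F.filter fun E => x ∈ E ∨ y ∈ E) ⊆ F := filter_subset _ _
  have hsd : n * ((F \ F.filter fun E => x ∈ E ∨ y ∈ E).card : ℝ) ≤
      r ^ 4 * (n : ℝ) ^ (r - 3) := by
    refine le_trans (mul_le_mul_of_nonneg_left (Nat.cast_le.2 (card_le_card ?_))
      (Nat.cast_nonneg _)) (by exact_mod_cast mul_card_not_heavy_le hr hF hcov)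
    intro E hE
    simp only [mem_sdiff, mem_filter, not_and] at hE ⊢
    exact ⟨hE.1, fun K hK hKE => hE.2 hE.1 ((h K hK).imp (fun h => hKE h) fun h => hKE h)⟩
  obtain ⟨h1, h2⟩ := small_diversity_of_cover hn hr (hF.mono hG) (x := x) (y := y)
    fun E hE => (mem_filter.1 hE).2
  have hn0 : (0 : ℝ) ≤ n := Nat.cast_nonneg _
  have d1 := mul_le_mul_of_nonneg_left
    (diversity_le_add_card (n := n) (C := 2) (by norm_num) hG) hn0
  have d2 := mul_le_mul_of_nonneg_left
    (diversity_le_add_card (n := n) (C := 3 / 2) (by norm_num) hG) hn0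
  have h1' := mul_le_mul_of_nonneg_left h1 hn0
  have hP : (0 : ℝ) ≤ (n : ℝ) ^ (r - 3) := by positivity
  have hrr : (r : ℝ) ^ 3 ≤ r ^ 4 :=
    pow_le_pow_right₀ (by exact_mod_cast (by omega : 1 ≤ r)) (by norm_num)
  have hrr' := mul_le_mul_of_nonneg_right hrr hP
  have : (0 : ℝ) ≤ r ^ 4 * (n : ℝ) ^ (r - 3) := by positivity
  constructor <;> linarith

theorem small_diversity_or_fano_or_sextuple (hn : 2 ≤ n) (hr : 3 ≤ r)
    (hF : IsIntersectingFamily n r F) :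
    (n * diversity n 2 F ≤ 2 * r ^ 4 * (n : ℝ) ^ (r - 3) ∧ n * diversity n (3 / 2) F ≤
      9 / 4 * (n * (n - 3).choose (r - 3)) + 2 * r ^ 4 * (n : ℝ) ^ (r - 3)) ∨
    (∃ f : ℕ → ℕ, Set.InjOn f (Icc 1 7 : Finset ℕ) ∧
      ∀ L ∈ fano, L.image f ∈ heavySets n r F) ∨
    ∃ X ⊆ Icc 1 n, X.card = 6 ∧ (∀ K ∈ heavySets n r F, K ⊆ X) ∧
      (heavySets n r F).card = 10 ∧ ∀ x y, ∃ K ∈ heavySets n r F, x ∉ K ∧ y ∉ K := by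
  have hP : (0 : ℝ) ≤ r ^ 4 * (n : ℝ) ^ (r - 3) := by positivity
  by_cases hcov : ∀ x y, ∃ E ∈ F, x ∉ E ∧ y ∉ E
  swap
  · left
    simp only [not_forall, not_exists, not_and, not_not] at hcov
    obtain ⟨x, y, h⟩ := hcov
    obtain ⟨h1, h2⟩ := small_diversity_of_cover hn hr hF (x := x) (y := y) fun E hE =>
      or_iff_not_imp_left.2 (h E hE)
    have hrr : (r : ℝ) ^ 3 ≤ r ^ 4 :=
      pow_le_pow_right₀ (by exact_mod_cast (by omega : 1 ≤ r)) (by norm_num)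
    have hrr' := mul_le_mul_of_nonneg_right hrr (by positivity : (0 : ℝ) ≤ (n : ℝ) ^ (r - 3))
    have h1' := mul_le_mul_of_nonneg_left h1 (Nat.cast_nonneg n)
    constructor <;> linarith
  by_cases hcovH : ∀ x y, ∃ K ∈ heavySets n r F, x ∉ K ∧ y ∉ K
  swap
  · left
    simp only [not_forall, not_exists, not_and, not_not] at hcovH
    obtain ⟨x, y, h⟩ := hcovH
    exact small_diversity_of_heavySets_cover hn hr hF hcov fun K hK =>
      or_iff_not_imp_left.2 (h K hK)
  have hint : ∀ A ∈ heavySets n r F, ∀ B ∈ heavySets n r F, (A ∩ B).Nonempty :=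
    fun A hA B hB => heavySets_inter_nonempty hr hF hA hB
  have h3 : ∀ K ∈ heavySets n r F, K.card = 3 := fun K hK => card_of_mem_heavySets hK
  have hU : (heavySets n r F).biUnion id ⊆ Icc 1 n :=
    biUnion_subset.2 fun K hK => subset_Icc_of_mem_heavySets hK
  have small : ∀ X ⊆ Icc 1 n, X.Nonempty →
      (∀ K ∈ heavySets n r F, X.card ≤ 2 * (K ∩ X).card) →
      ((heavySets n r F).filter fun K => 3 * (K ∩ X).card < 2 * X.card).card ≤ 9 →
      n * diversity n 2 F ≤ 2 * r ^ 4 * (n : ℝ) ^ (r - 3) ∧ n * diversity n (3 / 2) F ≤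
        9 / 4 * (n * (n - 3).choose (r - 3)) + 2 * r ^ 4 * (n : ℝ) ^ (r - 3) := by
    intro X hX hX' hhalf h9
    have h1 := mul_diversity_two_le_of_half hr hF hcov hX hX' hhalf
    -- Nine triples of weight 1 - (3/2)/2 = 1/4 give the constant 9/4.
    have h2 := mul_diversity_le_of_half hr hF hcov le_rfl (by norm_num) hX hX' hhalf h9
    norm_num at h2
    constructor <;> linarith
  obtain h | ⟨X, hX, hX6, hHX⟩ | ⟨X, hX, hX4, hHX⟩ := fano_or_sextuple_or_quadruple hint h3 hcovH
  · exact Or.inr (Or.inl h)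
  · obtain h9 | h10 : (heavySets n r F).card ≤ 9 ∨ (heavySets n r F).card = 10 := by
      have := (union_compl_eq_of_sextuple hint h3 hX6 hHX).1
      omega
    · left
      refine small X (hX.trans hU) (card_pos.1 (by omega)) (fun K hK => ?_)
        ((card_filter_le _ _).trans h9)
      rw [inter_eq_left.2 (hHX K hK), h3 K hK, hX6]
    · exact Or.inr (Or.inr ⟨X, hX.trans hU, hX6, hHX, h10, hcovH⟩)
  · left
    refine small X (hX.trans hU) (card_pos.1 (by omega)) (fun K hK => ?_)
      (le_trans (card_le_card fun K hK => ?_)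
        ((card_le_six_of_quadruple hint h3 hcovH hX4 hHX).trans (by norm_num)))
    · have := hHX K hK
      omega
    · rw [mem_filter] at hK ⊢
      have := hHX K hK.1
      exact ⟨hK.1, by omega⟩

/-- Edges meet all heavy triples, which have no 2-cover, so traces on X have at least three points.
A three-point trace is heavy, since otherwise its complement would be a heavy triple missing the
edge. Larger traces have nonpositive weight. There is no error term, as the tie at C = 3/2 requires.
-/
theorem diversity_le_of_sextuple (hr : 3 ≤ r) (hF : IsIntersectingFamily n r F) {C : ℝ}
    (hC : 3 / 2 ≤ C) (hC' : C ≤ 2) {X : Finset ℕ} (hX : X ⊆ Icc 1 n) (hX6 : X.card = 6)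
    (hHX : ∀ K ∈ heavySets n r F, K ⊆ X) (h10 : (heavySets n r F).card = 10)
    (hcov : ∀ x y, ∃ K ∈ heavySets n r F, x ∉ K ∧ y ∉ K) :
    diversity n C F ≤ (10 - 5 * C) * (n - 6).choose (r - 3) := by
  have hint : ∀ A ∈ heavySets n r F, ∀ B ∈ heavySets n r F, (A ∩ B).Nonempty :=
    fun A hA B hB => heavySets_inter_nonempty hr hF hA hB
  have h3 : ∀ K ∈ heavySets n r F, K.card = 3 := fun K hK => card_of_mem_heavySets hK
  have hmeet : ∀ E ∈ F, ∀ K ∈ heavySets n r F, ((E ∩ X) ∩ K).Nonempty := by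
    intro E hE K hK
    obtain ⟨w, hw⟩ := inter_heavySet_nonempty hF hE hK
    rw [mem_inter] at hw
    exact ⟨w, by simp [hw.1, hw.2, hHX K hK hw.2]⟩
  have hthree : ∀ E ∈ F, 3 ≤ (E ∩ X).card := by
    intro E hE
    by_contra hlt
    obtain ⟨S, h1, -, hS⟩ := exists_subsuperset_card_eq
      (inter_subset_right : E ∩ X ⊆ X) (n := 2) (by omega) (by omega)
    obtain ⟨x, y, -, rfl⟩ := card_eq_two.1 hS
    obtain ⟨K, hK, hx, hy⟩ := hcov x y
    obtain ⟨w, hw⟩ := hmeet E hE K hK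
    rw [mem_inter] at hw
    have := h1 hw.1
    rw [mem_insert, mem_singleton] at this
    obtain rfl | rfl := this
    · exact hx hw.2
    · exact hy hw.2
  have hmem : ∀ E ∈ F, (E ∩ X).card = 3 → E ∩ X ∈ heavySets n r F := by
    intro E hE hE3
    refine ((union_compl_eq_of_sextuple hint h3 hX6 hHX).2 h10.ge _ inter_subset_right
      hE3).resolve_right fun h => ?_
    obtain ⟨w, hw⟩ := hmeet E hE _ h
    rw [mem_inter, mem_sdiff] at hw
    exact hw.2.2 hw.1
  have h1 : diversity n C F ≤ ∑ E ∈ F, if E ∩ X ∈ heavySets n r F then 1 - C / 2 else 0 := by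
    refine (diversity_le_sum (by linarith) hX (card_pos.1 (by omega)) F).trans
      (sum_le_sum fun E hE => ?_)
    have h4 := hthree E hE
    rw [hX6]
    split_ifs with h
    · rw [h3 _ h]
      push_cast
      linarith
    · have h5 : 4 ≤ (E ∩ X).card := by
        by_contra hlt
        exact h (hmem E hE (by omega))
      have h6 : (4 : ℝ) ≤ (E ∩ X).card := by exact_mod_cast h5
      push_cast
      nlinarith
  rw [← sum_filter, sum_const, nsmul_eq_mul] at h1
  have h2 : (F.filter fun E => E ∩ X ∈ heavySets n r F).card ≤ 10 * (n - 6).choose (r - 3) := by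
    calc (F.filter fun E => E ∩ X ∈ heavySets n r F).card
        ≤ ((heavySets n r F).biUnion fun T =>
            ((Icc 1 n).powersetCard r).filter fun E => E ∩ X = T).card := by
          refine card_le_card fun E hE => ?_
          rw [mem_filter] at hE
          exact mem_biUnion.2 ⟨_, hE.2, mem_filter.2 ⟨hF.1 hE.1, rfl⟩⟩
      _ ≤ (heavySets n r F).card • (n - 6).choose (r - 3) := by
          refine card_biUnion_le.trans (sum_le_card_nsmul _ _ _ fun T hT => ?_)
          rw [card_trace_eq _ _ _ _ hX (hHX T hT), h3 T hT, hX6, if_pos hr, Nat.card_Icc,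
            Nat.add_sub_cancel]
      _ = _ := by rw [h10, smul_eq_mul]
  have h3 : ((F.filter fun E => E ∩ X ∈ heavySets n r F).card : ℝ) ≤
      10 * (n - 6).choose (r - 3) := by exact_mod_cast h2
  have := mul_le_mul_of_nonneg_right h3 (by linarith : 0 ≤ 1 - C / 2)
  linarith

end Dichotomy
end Diversity

/-! ### The two Fano families: sizes, degrees and diversities -/

namespace Diversity
open Finset

theorem card_fano : fano.card = 7 := by decide +kernel

theorem card_of_mem_fano : ∀ L ∈ fano, L.card = 3 := by decide +kernel

theorem degree_fano : ∀ v ∈ Icc 1 7, degree fano v = 3 := by decide +kernel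

theorem card_fanoPlus_sdiff : (fanoPlus \ fano).card = 28 := by decide +kernel

theorem card_of_mem_fanoPlus_sdiff : ∀ L ∈ fanoPlus \ fano, L.card = 4 := by decide +kernel

theorem degree_fanoPlus_sdiff : ∀ v ∈ Icc 1 7, degree (fanoPlus \ fano) v = 16 := by
  decide +kernel

theorem fanoPlus_subset : ∀ L ∈ fanoPlus, L ⊆ Icc 1 7 := by decide +kernel

theorem fanoPlus_inter_nonempty : ∀ A ∈ fanoPlus, ∀ B ∈ fanoPlus, (A ∩ B).Nonempty := by
  decide +kernel

theorem mem_fanoPlus_or_five_le : ∀ T ∈ (Icc 1 7).powerset, (∀ L ∈ fano, (T ∩ L).Nonempty) →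
    T ∈ fanoPlus ∨ 5 ≤ T.card := by
  decide +kernel

theorem fano_subset_fanoPlus : fano ⊆ fanoPlus := subset_union_left

/-- The family of the `r`-subsets of `[n]` whose trace on `[7]` belongs to `S`. -/
def traceFamily (n r : ℕ) (S : Finset (Finset ℕ)) : Finset (Finset ℕ) :=
  ((Icc 1 n).powersetCard r).filter fun E => E ∩ Icc 1 7 ∈ S

/-- The number of `r`-subsets of `[n]` with a given trace of size `k` on `[7]`. -/
def traceCount (n r k : ℕ) : ℕ :=
  if k ≤ r then (n - 7).choose (r - k) else 0

section Trace

variable {n r : ℕ} {S : Finset (Finset ℕ)}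

theorem isIntersectingFamily_traceFamily (hS : ∀ A ∈ S, ∀ B ∈ S, (A ∩ B).Nonempty) :
    IsIntersectingFamily n r (traceFamily n r S) := by
  refine ⟨filter_subset _ _, fun A hA B hB => ?_⟩
  obtain ⟨w, hw⟩ := hS _ (mem_filter.1 hA).2 _ (mem_filter.1 hB).2
  simp only [mem_inter] at hw
  exact ⟨w, mem_inter.2 ⟨hw.1.1, hw.2.1⟩⟩

theorem card_traceFamily (hn : 7 ≤ n) (hS : ∀ T ∈ S, T ⊆ Icc 1 7) :
    (traceFamily n r S).card = ∑ T ∈ S, traceCount n r T.card := by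
  have hmaps : Set.MapsTo (fun E : Finset ℕ => E ∩ Icc 1 7) (traceFamily n r S) S :=
    fun E hE => (mem_filter.1 hE).2
  rw [card_eq_sum_card_fiberwise hmaps]
  refine sum_congr rfl fun T hT => ?_
  rw [traceFamily, filter_filter, ← show _ = traceCount n r T.card from
    (card_trace_eq (Icc 1 n) (Icc 1 7) T r (Icc_subset_Icc_right hn) (hS T hT)).trans
      (by simp [traceCount])]
  congr 1
  exact filter_congr fun E _ => ⟨fun h => h.2, fun h => ⟨h ▸ hT, h⟩⟩

theorem degree_traceFamily (hn : 7 ≤ n) (hS : ∀ T ∈ S, T ⊆ Icc 1 7) {v : ℕ} (hv : v ∈ Icc 1 7) :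
    degree (traceFamily n r S) v = ∑ T ∈ S.filter fun T => v ∈ T, traceCount n r T.card := by
  rw [← card_traceFamily hn fun T hT => hS T (mem_filter.1 hT).1, degree, traceFamily,
    filter_filter, traceFamily]
  congr 1
  refine filter_congr fun E _ => ?_
  rw [mem_filter, mem_inter]
  tauto

theorem card_trace_mem_le (hn : 8 ≤ n) {T : Finset ℕ} (hT : T ⊆ Icc 1 7) {v : ℕ}
    (hv : v ∈ Icc 1 n) (hv7 : v ∉ Icc 1 7) :
    (n - 7) * (((Icc 1 n).powersetCard r).filter fun E => E ∩ Icc 1 7 = T ∧ v ∈ E).card ≤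
      r * traceCount n r T.card := by
  have h1 : (((Icc 1 n).powersetCard r).filter fun E => E ∩ Icc 1 7 = T ∧ v ∈ E) =
      ((Icc 1 n).powersetCard r).filter fun E => E ∩ insert v (Icc 1 7) = insert v T := by
    refine filter_congr fun E _ => ⟨?_, fun h => ?_⟩
    · rintro ⟨rfl, hvE⟩
      rw [inter_insert_of_mem hvE]
    · have hvE : v ∈ E := (mem_inter.1 (h ▸ mem_insert_self v T : v ∈ E ∩ _)).1
      refine ⟨?_, hvE⟩
      rw [inter_insert_of_mem hvE] at h
      have hvT : v ∉ T := fun h => hv7 (hT h)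
      have hvE' : v ∉ E ∩ Icc 1 7 := fun h => hv7 (mem_inter.1 h).2
      rw [← erase_insert hvE', h, erase_insert hvT]
  rw [h1, card_trace_eq _ _ _ _
    (insert_subset hv (Icc_subset_Icc_right (by omega))) (insert_subset_insert _ hT),
    card_insert_of_notMem hv7, card_insert_of_notMem fun h => hv7 (hT h), traceCount,
    Nat.card_Icc, Nat.card_Icc]
  split_ifs with h2 h3 h3
  · obtain ⟨m, rfl⟩ : ∃ m, n = m + 8 := ⟨n - 8, by omega⟩
    obtain ⟨j, hj⟩ : ∃ j, r = T.card + 1 + j := ⟨r - (T.card + 1), by omega⟩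
    have e1 : m + 8 + 1 - 1 - (7 + 1 - 1 + 1) = m := by omega
    have e2 : r - (T.card + 1) = j := by omega
    have e3 : m + 8 - 7 = m + 1 := by omega
    have e4 : r - T.card = j + 1 := by omega
    rw [e1, e2, e3, e4, Nat.add_one_mul_choose_eq, mul_comm]
    exact Nat.mul_le_mul_right _ (by omega)
  · omega
  · simp
  · simp

theorem mul_degree_traceFamily_le (hn : 8 ≤ n) (hS : ∀ T ∈ S, T ⊆ Icc 1 7) {v : ℕ}
    (hv : v ∈ Icc 1 n) (hv7 : v ∉ Icc 1 7) :
    (n - 7) * degree (traceFamily n r S) v ≤ r * (traceFamily n r S).card := by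
  have h1 : degree (traceFamily n r S) v ≤ ∑ T ∈ S,
      (((Icc 1 n).powersetCard r).filter fun E => E ∩ Icc 1 7 = T ∧ v ∈ E).card := by
    refine le_trans (card_le_card fun E hE => ?_) card_biUnion_le
    rw [traceFamily, filter_filter, mem_filter] at hE
    exact mem_biUnion.2 ⟨_, hE.2.1, mem_filter.2 ⟨hE.1, rfl, hE.2.2⟩⟩
  rw [card_traceFamily (by omega) hS, mul_sum]
  refine (Nat.mul_le_mul_left _ h1).trans ?_
  rw [mul_sum]
  exact sum_le_sum fun T hT => card_trace_mem_le hn (hS T hT) hv hv7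

/-- A vertex outside [7] lies in at most a fraction r/(n - 7) of the edges, so for large n the
maximum is attained on [7]. -/
theorem maxDegree_traceFamily (hn : 8 ≤ n) (hS : ∀ T ∈ S, T ⊆ Icc 1 7) {d : ℕ}
    (hd : ∀ v ∈ Icc 1 7, degree (traceFamily n r S) v = d)
    (hd' : r * (traceFamily n r S).card ≤ (n - 7) * d) :
    maxDegree n (traceFamily n r S) = d := by
  refine le_antisymm (Finset.sup_le fun v hv => ?_) ?_
  · by_cases hv7 : v ∈ Icc 1 7
    · exact (hd v hv7).le
    · exact le_of_mul_le_mul_left ((mul_degree_traceFamily_le hn hS hv hv7).trans hd') (by omega)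
  · rw [← hd 1 (by simp)]
    exact degree_le_maxDegree (by simp; omega)

end Trace

section FanoFamilies

variable {n r : ℕ}

theorem card_familyFano (hn : 7 ≤ n) : (familyFano n r).card = 7 * traceCount n r 3 := by
  rw [show familyFano n r = traceFamily n r fano from rfl,
    card_traceFamily hn fun T hT => fanoPlus_subset T (fano_subset_fanoPlus hT),
    sum_congr rfl fun T hT => by rw [card_of_mem_fano T hT], sum_const, card_fano, smul_eq_mul]

theorem degree_familyFano (hn : 7 ≤ n) {v : ℕ} (hv : v ∈ Icc 1 7) :
    degree (familyFano n r) v = 3 * traceCount n r 3 := by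
  rw [show familyFano n r = traceFamily n r fano from rfl,
    degree_traceFamily hn (fun T hT => fanoPlus_subset T (fano_subset_fanoPlus hT)) hv,
    sum_congr rfl fun T hT => by rw [card_of_mem_fano T (mem_filter.1 hT).1], sum_const,
    smul_eq_mul]
  congr 1
  exact degree_fano v hv

theorem familyFanoPlus_eq : familyFanoPlus n r =
    familyFano n r ∪ traceFamily n r (fanoPlus \ fano) := by
  ext E
  simp only [familyFanoPlus, familyFano, traceFamily, mem_union, mem_filter, mem_sdiff]
  have := @fano_subset_fanoPlus (E ∩ Icc 1 7)
  tauto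

theorem disjoint_familyFano : Disjoint (familyFano n r) (traceFamily n r (fanoPlus \ fano)) := by
  rw [disjoint_left]
  intro E hE hE'
  exact (mem_sdiff.1 (mem_filter.1 hE').2).2 (mem_filter.1 hE).2

theorem card_familyFanoPlus (hn : 7 ≤ n) :
    (familyFanoPlus n r).card = 7 * traceCount n r 3 + 28 * traceCount n r 4 := by
  rw [familyFanoPlus_eq, card_union_of_disjoint disjoint_familyFano, card_familyFano hn,
    card_traceFamily hn fun T hT => fanoPlus_subset T (mem_sdiff.1 hT).1,
    sum_congr rfl fun T hT => by rw [card_of_mem_fanoPlus_sdiff T hT], sum_const,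
    card_fanoPlus_sdiff, smul_eq_mul]

theorem degree_familyFanoPlus (hn : 7 ≤ n) {v : ℕ} (hv : v ∈ Icc 1 7) :
    degree (familyFanoPlus n r) v = 3 * traceCount n r 3 + 16 * traceCount n r 4 := by
  have h1 : degree (familyFanoPlus n r) v =
      degree (familyFano n r) v + degree (traceFamily n r (fanoPlus \ fano)) v := by
    rw [familyFanoPlus_eq, degree, filter_union]
    exact card_union_of_disjoint (disjoint_filter_filter disjoint_familyFano)
  rw [h1, degree_familyFano hn hv,
    degree_traceFamily hn (fun T hT => fanoPlus_subset T (mem_sdiff.1 hT).1) hv,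
    sum_congr rfl fun T hT => by rw [card_of_mem_fanoPlus_sdiff T (mem_filter.1 hT).1], sum_const,
    smul_eq_mul]
  congr 2
  exact degree_fanoPlus_sdiff v hv

theorem diversity_familyFano (hn : 3 * r + 8 ≤ n) (C : ℝ) :
    diversity n C (familyFano n r) = (7 - 3 * C) * traceCount n r 3 := by
  have h1 : maxDegree n (familyFano n r) = 3 * traceCount n r 3 := by
    refine maxDegree_traceFamily (by omega)
      (fun T hT => fanoPlus_subset T (fano_subset_fanoPlus hT))
      (fun v hv => degree_familyFano (by omega) hv) ?_
    rw [← show familyFano n r = traceFamily n r fano from rfl, card_familyFano (by omega)]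
    calc r * (7 * traceCount n r 3) ≤ 3 * r * (3 * traceCount n r 3) := by
          have : 0 ≤ r * traceCount n r 3 := Nat.zero_le _
          nlinarith
      _ ≤ _ := Nat.mul_le_mul_right _ (by omega)
  rw [diversity, h1, card_familyFano (by omega)]
  push_cast
  ring

theorem diversity_familyFanoPlus (hn : 3 * r + 8 ≤ n) (C : ℝ) :
    diversity n C (familyFanoPlus n r) =
      (7 - 3 * C) * traceCount n r 3 + (28 - 16 * C) * traceCount n r 4 := by
  have h1 : maxDegree n (familyFanoPlus n r) = 3 * traceCount n r 3 + 16 * traceCount n r 4 := by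
    refine maxDegree_traceFamily (by omega) fanoPlus_subset
      (fun v hv => degree_familyFanoPlus (by omega) hv) ?_
    rw [← show familyFanoPlus n r = traceFamily n r fanoPlus from rfl,
      card_familyFanoPlus (by omega)]
    calc r * (7 * traceCount n r 3 + 28 * traceCount n r 4)
        ≤ 3 * r * (3 * traceCount n r 3 + 16 * traceCount n r 4) := by
          have : 0 ≤ r * traceCount n r 3 := Nat.zero_le _
          have : 0 ≤ r * traceCount n r 4 := Nat.zero_le _
          nlinarith
      _ ≤ _ := Nat.mul_le_mul_right _ (by omega)
  rw [diversity, h1, card_familyFanoPlus (by omega)]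
  push_cast
  ring

theorem sum_familyFano (hn : 7 ≤ n) (C : ℝ) :
    ∑ E ∈ familyFano n r, (1 - C * ((E ∩ Icc 1 7).card / (7 : ℝ))) =
      (7 - 3 * C) * traceCount n r 3 := by
  rw [sum_congr rfl fun E hE => by rw [card_of_mem_fano _ (mem_filter.1 hE).2], sum_const,
    card_familyFano hn, nsmul_eq_mul]
  push_cast
  ring

theorem sum_familyFanoPlus (hn : 7 ≤ n) (C : ℝ) :
    ∑ E ∈ familyFanoPlus n r, (1 - C * ((E ∩ Icc 1 7).card / (7 : ℝ))) =
      (7 - 3 * C) * traceCount n r 3 + (28 - 16 * C) * traceCount n r 4 := by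
  rw [familyFanoPlus_eq, sum_union disjoint_familyFano, sum_familyFano hn,
    sum_congr rfl fun E hE => by rw [card_of_mem_fanoPlus_sdiff _ (mem_filter.1 hE).2], sum_const,
    card_traceFamily hn fun T hT => fanoPlus_subset T (mem_sdiff.1 hT).1,
    sum_congr rfl fun T hT => by rw [card_of_mem_fanoPlus_sdiff T hT], sum_const,
    card_fanoPlus_sdiff, nsmul_eq_mul, smul_eq_mul]
  push_cast
  ring

end FanoFamilies

/-- After cancelling A ∩ F, the nonnegative sum over A \ F is at most the nonpositive sum over F \
A, so both vanish. -/
theorem subset_and_eq_zero_of_sum_le {α : Type*} [DecidableEq α] {A F : Finset α} {f : α → ℝ}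
    (hA : ∀ E ∈ A, 0 < f E) (hF : ∀ E ∈ F \ A, f E ≤ 0) (h : ∑ E ∈ A, f E ≤ ∑ E ∈ F, f E) :
    A ⊆ F ∧ ∀ E ∈ F \ A, f E = 0 := by
  rw [← sum_inter_add_sum_sdiff A F, ← sum_inter_add_sum_sdiff F A, inter_comm F A] at h
  have h1 : ∑ E ∈ F \ A, f E ≤ 0 := sum_nonpos hF
  have h2 : 0 ≤ ∑ E ∈ A \ F, f E := sum_nonneg fun E hE => (hA E (mem_sdiff.1 hE).1).le
  constructor
  · rw [← sdiff_eq_empty_iff_subset]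
    by_contra hne
    have := sum_pos (fun E hE => hA E (mem_sdiff.1 hE).1) (nonempty_iff_ne_empty.2 hne)
    linarith
  · exact (sum_eq_zero_iff_of_nonpos hF).1 (by linarith)

theorem eq_of_sum_le {α : Type*} [DecidableEq α] {A F : Finset α} {f : α → ℝ}
    (hA : ∀ E ∈ A, 0 < f E) (hF : ∀ E ∈ F \ A, f E < 0) (h : ∑ E ∈ A, f E ≤ ∑ E ∈ F, f E) :
    F = A := by
  obtain ⟨h1, h2⟩ := subset_and_eq_zero_of_sum_le hA (fun E hE => (hF E hE).le) h
  refine Subset.antisymm (fun E hE => ?_) h1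
  by_contra hEA
  have hm := mem_sdiff.2 ⟨hE, hEA⟩
  exact (hF E hm).ne (h2 E hm)

/-! ### Extremal families whose edges meet every line -/

section Extremal

variable {n r : ℕ} {C : ℝ} {F : Finset (Finset ℕ)}

theorem trace_of_meets_fano (hF : F ⊆ (Icc 1 n).powersetCard r)
    (hmeet : ∀ E ∈ F, ∀ L ∈ fano, (E ∩ L).Nonempty) {E : Finset ℕ} (hE : E ∈ F) :
    E ∈ familyFano n r ∨ (E ∈ familyFanoPlus n r ∧ (E ∩ Icc 1 7).card = 4) ∨
      5 ≤ (E ∩ Icc 1 7).card := by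
  obtain h | h := mem_fanoPlus_or_five_le (E ∩ Icc 1 7) (mem_powerset.2 inter_subset_right)
    fun L hL => by
      obtain ⟨w, hw⟩ := hmeet E hE L hL
      rw [mem_inter] at hw
      have := fanoPlus_subset L (fano_subset_fanoPlus hL) hw.2
      exact ⟨w, mem_inter.2 ⟨mem_inter.2 ⟨hw.1, this⟩, hw.2⟩⟩
  · by_cases h' : E ∩ Icc 1 7 ∈ fano
    · exact Or.inl (mem_filter.2 ⟨hF hE, h'⟩)
    · exact Or.inr (Or.inl ⟨mem_filter.2 ⟨hF hE, h⟩,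
        card_of_mem_fanoPlus_sdiff _ (mem_sdiff.2 ⟨h, h'⟩)⟩)
  · exact Or.inr (Or.inr h)

theorem diversity_le_sum_fano (hn : 7 ≤ n) (hC : 0 ≤ C) (F : Finset (Finset ℕ)) :
    diversity n C F ≤ ∑ E ∈ F, (1 - C * ((E ∩ Icc 1 7).card / (7 : ℝ))) := by
  have := diversity_le_sum hC (Icc_subset_Icc_right hn : Icc 1 7 ⊆ Icc 1 n) ⟨1, by simp⟩ F
  simpa using this

/-- In this range 1 - Ck/7 is positive for k = 3, 4 and negative for k ≥ 5, so any departure from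
`familyFanoPlus` lowers the sum of weights. -/
theorem eq_familyFanoPlus (hn : 3 * r + 8 ≤ n) (hC : 3 / 2 ≤ C) (hC' : C < 7 / 4)
    (hF : F ⊆ (Icc 1 n).powersetCard r) (hmeet : ∀ E ∈ F, ∀ L ∈ fano, (E ∩ L).Nonempty)
    (hmax : diversity n C (familyFanoPlus n r) ≤ diversity n C F) : F = familyFanoPlus n r := by
  have h1 := hmax.trans (diversity_le_sum_fano (by omega) (by linarith) F)
  rw [diversity_familyFanoPlus hn, ← sum_familyFanoPlus (by omega)] at h1
  refine eq_of_sum_le (fun E hE => ?_) (fun E hE => ?_) h1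
  · rw [familyFanoPlus_eq, mem_union] at hE
    obtain hE | hE := hE
    · rw [card_of_mem_fano _ (mem_filter.1 hE).2]
      push_cast
      linarith
    · rw [card_of_mem_fanoPlus_sdiff _ (mem_filter.1 hE).2]
      push_cast
      linarith
  · rw [mem_sdiff] at hE
    obtain h | h | h := trace_of_meets_fano hF hmeet hE.1
    · rw [familyFanoPlus_eq, mem_union] at hE
      exact absurd (Or.inl h) hE.2
    · exact absurd h.1 hE.2
    · have : (5 : ℝ) ≤ (E ∩ Icc 1 7).card := by exact_mod_cast h
      nlinarith

theorem eq_familyFano (hn : 3 * r + 8 ≤ n) (hC : 7 / 4 < C) (hC' : C < 7 / 3)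
    (hF : F ⊆ (Icc 1 n).powersetCard r) (hmeet : ∀ E ∈ F, ∀ L ∈ fano, (E ∩ L).Nonempty)
    (hmax : diversity n C (familyFano n r) ≤ diversity n C F) : F = familyFano n r := by
  have h1 := hmax.trans (diversity_le_sum_fano (by omega) (by linarith) F)
  rw [diversity_familyFano hn, ← sum_familyFano (by omega)] at h1
  refine eq_of_sum_le (fun E hE => ?_) (fun E hE => ?_) h1
  · rw [card_of_mem_fano _ (mem_filter.1 hE).2]
    push_cast
    linarith
  · rw [mem_sdiff] at hE
    have : (4 : ℝ) ≤ (E ∩ Icc 1 7).card := by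
      obtain h | h | h := trace_of_meets_fano hF hmeet hE.1
      · exact absurd h hE.2
      · exact_mod_cast h.2.ge
      · exact_mod_cast (by omega : 4 ≤ (E ∩ Icc 1 7).card)
    nlinarith

/-- Four-point traces now have weight 0, so they may be added freely as far as the sum of weights is
concerned. Maximality forces equality in the averaging bound, so F is regular on [7], which gives
the degree condition. -/
theorem between_familyFano (hn : 3 * r + 8 ≤ n) (hC : C = 7 / 4)
    (hF : F ⊆ (Icc 1 n).powersetCard r) (hmeet : ∀ E ∈ F, ∀ L ∈ fano, (E ∩ L).Nonempty)
    (hmax : diversity n C (familyFano n r) ≤ diversity n C F) :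
    familyFano n r ⊆ F ∧ F ⊆ familyFanoPlus n r ∧
      (∀ v ∈ Icc 1 7, ((F \ familyFano n r).card : ℝ) -
        C * (degree (F \ familyFano n r) v : ℝ) = 0) ∧
      diversity n C F = diversity n C (familyFano n r) := by
  have hd := diversity_le_sum_fano (n := n) (by omega) (by linarith : 0 ≤ C) F
  have h1 := hmax.trans hd
  rw [diversity_familyFano hn, ← sum_familyFano (by omega)] at h1
  obtain ⟨hsub, hzero⟩ := subset_and_eq_zero_of_sum_le (fun E hE => by
      rw [card_of_mem_fano _ (mem_filter.1 hE).2]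
      push_cast
      linarith) (fun E hE => by
      rw [mem_sdiff] at hE
      have : (4 : ℝ) ≤ (E ∩ Icc 1 7).card := by
        obtain h | h | h := trace_of_meets_fano hF hmeet hE.1
        · exact absurd h hE.2
        · exact_mod_cast h.2.ge
        · exact_mod_cast (by omega : 4 ≤ (E ∩ Icc 1 7).card)
      rw [hC]
      linarith) h1
  have hdiv : diversity n C F = diversity n C (familyFano n r) := by
    refine le_antisymm (hd.trans ?_) hmax
    rw [← sum_sdiff hsub, sum_eq_zero hzero, zero_add, sum_familyFano (by omega),
      diversity_familyFano hn]
  have hcard : F.card = (F \ familyFano n r).card + 7 * traceCount n r 3 := by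
    rw [← card_familyFano (by omega), card_sdiff_add_card_eq_card hsub]
  have hdeg : ∀ v ∈ Icc 1 7,
      degree F v = degree (F \ familyFano n r) v + 3 * traceCount n r 3 := by
    intro v hv
    rw [← degree_familyFano (by omega) hv, degree, degree, degree,
      ← card_union_of_disjoint (disjoint_filter_filter sdiff_disjoint), ← filter_union,
      sdiff_union_of_subset hsub]
  have hsum : ∑ E ∈ F, (1 - C * ((E ∩ Icc 1 7).card / (7 : ℝ))) = diversity n C F := by
    refine le_antisymm ?_ hd
    rw [← sum_sdiff hsub, sum_eq_zero hzero, zero_add, sum_familyFano (by omega), hdiv,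
      diversity_familyFano hn]
  have hmaxdeg : ∀ v ∈ Icc 1 7, degree F v = maxDegree n F := by
    have hle : ∀ v ∈ Icc 1 7, degree F v ≤ maxDegree n F := fun v hv =>
      degree_le_maxDegree (Icc_subset_Icc_right (by omega) hv)
    -- Seven degrees, each at most Δ, with sum 7Δ.
    refine (sum_eq_sum_iff_of_le hle).1 ?_
    rw [sum_degree_eq, sum_const, Nat.card_Icc, smul_eq_mul]
    rw [sum_sub_distrib, ← mul_sum, ← sum_div, sum_const, nsmul_eq_mul, diversity] at hsum
    have : ∑ E ∈ F, ((E ∩ Icc 1 7).card : ℝ) = 7 * maxDegree n F := by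
      rw [hC] at hsum
      linarith
    exact_mod_cast this
  refine ⟨hsub, fun E hE => ?_, fun v hv => ?_, hdiv⟩
  · obtain h | h | h := trace_of_meets_fano hF hmeet hE
    · rw [familyFanoPlus_eq]
      exact mem_union_left _ h
    · exact h.1
    · by_cases hEA : E ∈ familyFano n r
      · rw [familyFanoPlus_eq]
        exact mem_union_left _ hEA
      · have h0 := hzero E (mem_sdiff.2 ⟨hE, hEA⟩)
        have : (5 : ℝ) ≤ (E ∩ Icc 1 7).card := by exact_mod_cast h
        rw [hC] at h0
        linarith
  · rw [diversity_familyFano hn, diversity, ← hmaxdeg v hv, hdeg v hv, hcard] at hdiv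
    push_cast at hdiv
    linarith

end Extremal
end Diversity

/-! ### Relabelling vertices -/

namespace Diversity
open Finset

section Relabel

variable {n r : ℕ} {σ : Equiv.Perm ℕ} {F G : Finset (Finset ℕ)}

theorem relabel_injective (σ : Equiv.Perm ℕ) :
    Function.Injective fun E : Finset ℕ => E.image σ :=
  image_injective σ.injective

theorem card_relabel (σ : Equiv.Perm ℕ) (F : Finset (Finset ℕ)) :
    (relabel σ F).card = F.card :=
  card_image_of_injective _ (relabel_injective σ)

theorem relabel_relabel_symm (σ : Equiv.Perm ℕ) (F : Finset (Finset ℕ)) :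
    relabel σ (relabel σ.symm F) = F := by
  simp [relabel, image_image, Function.comp_def]

theorem relabel_sdiff (σ : Equiv.Perm ℕ) (F G : Finset (Finset ℕ)) :
    relabel σ (F \ G) = relabel σ F \ relabel σ G :=
  image_sdiff _ _ (relabel_injective σ)

theorem degree_relabel (σ : Equiv.Perm ℕ) (F : Finset (Finset ℕ)) (v : ℕ) :
    degree (relabel σ F) (σ v) = degree F v := by
  have : (relabel σ F).filter (fun E => σ v ∈ E) = relabel σ (F.filter fun E => v ∈ E) := by
    rw [relabel, filter_image]
    simp [relabel]
  rw [degree, this, card_relabel, degree]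

theorem PermutesVertices.symm (hσ : PermutesVertices n σ) : PermutesVertices n σ.symm := by
  intro x
  rw [← hσ, σ.apply_symm_apply]

theorem maxDegree_relabel_le (hσ : PermutesVertices n σ) (F : Finset (Finset ℕ)) :
    maxDegree n (relabel σ F) ≤ maxDegree n F := by
  refine Finset.sup_le fun v hv => ?_
  rw [← σ.apply_symm_apply v, degree_relabel]
  exact degree_le_maxDegree ((hσ.symm v).2 hv)

theorem diversity_relabel (hσ : PermutesVertices n σ) (C : ℝ) (F : Finset (Finset ℕ)) :
    diversity n C (relabel σ F) = diversity n C F := by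
  have h : maxDegree n (relabel σ F) = maxDegree n F := by
    refine le_antisymm (maxDegree_relabel_le hσ F) ?_
    have := maxDegree_relabel_le hσ.symm (relabel σ F)
    rwa [show relabel σ.symm (relabel σ F) = F from relabel_relabel_symm σ.symm F] at this
  rw [diversity, diversity, h, card_relabel]

theorem isIntersectingFamily_relabel (hσ : PermutesVertices n σ)
    (hF : IsIntersectingFamily n r F) : IsIntersectingFamily n r (relabel σ F) := by
  refine ⟨fun E hE => ?_, fun A hA B hB => ?_⟩
  · obtain ⟨E, hE', rfl⟩ := mem_image.1 hE
    refine mem_powersetCard.2 ⟨fun x hx => ?_, ?_⟩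
    · obtain ⟨y, hy, rfl⟩ := mem_image.1 hx
      exact (hσ y).2 (hF.subset_Icc hE' hy)
    · rw [card_image_of_injective _ σ.injective, hF.card_eq hE']
  · obtain ⟨A, hA', rfl⟩ := mem_image.1 hA
    obtain ⟨B, hB', rfl⟩ := mem_image.1 hB
    rw [← image_inter _ _ σ.injective]
    exact (hF.2 A hA' B hB').image _

theorem exists_permutesVertices (f : ℕ → ℕ) (hn : 7 ≤ n)
    (hf : Set.InjOn f (Icc 1 7 : Finset ℕ)) (hfn : ∀ i ∈ Icc 1 7, f i ∈ Icc 1 n) :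
    ∃ σ : Equiv.Perm ℕ, PermutesVertices n σ ∧ ∀ i ∈ Icc 1 7, σ i = f i := by
  have hcard : Fintype.card (Icc 1 n : Finset ℕ) = (Icc 1 n : Finset ℕ).card := Fintype.card_coe _
  obtain ⟨g, hg⟩ := Finset.exists_equiv_extend_of_card_eq hcard (s := univ.filter fun x => x.1 ∈ Icc 1 7)
    (f := fun x => f x.1)
    (by
      intro y hy
      obtain ⟨x, hx, rfl⟩ := mem_image.1 hy
      exact hfn _ (mem_filter.1 hx).2)
    (by
      intro x hx y hy hxy
      exact Subtype.ext (hf (mem_filter.1 hx).2 (mem_filter.1 hy).2 hxy))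
  refine ⟨Equiv.Perm.ofSubtype (g : Equiv.Perm {x // x ∈ Icc 1 n}), fun x => ?_, fun i hi => ?_⟩
  · exact Equiv.Perm.ofSubtype_apply_mem_iff_mem (p := fun x => x ∈ Icc 1 n) g x
  · have hin : i ∈ Icc 1 n := Icc_subset_Icc_right hn hi
    rw [Equiv.Perm.ofSubtype_apply_of_mem _ hin]
    exact hg ⟨i, hin⟩ (by simpa using hi)

end Relabel

/-! ### Comparing binomial coefficients with powers of n -/

section Asymptotics

theorem mul_choose_succ_le {n m k : ℕ} (h : m ≤ n) :
    n * (m + 1).choose k ≤ n * m.choose k + n ^ k := by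
  cases k with
  | zero => simp
  | succ k =>
    rw [Nat.choose_succ_succ, mul_add, add_comm, pow_succ']
    gcongr
    exact (Nat.choose_le_pow _ _).trans (Nat.pow_le_pow_left h _)

theorem mul_choose_sub_three_le {n : ℕ} (k : ℕ) (hn : 7 ≤ n) :
    n * (n - 3).choose k ≤ n * (n - 7).choose k + 4 * n ^ k := by
  obtain ⟨m, rfl⟩ : ∃ m, n = m + 7 := ⟨n - 7, by omega⟩
  have h1 := mul_choose_succ_le (n := m + 7) (m := m) (k := k) (by omega)
  have h2 := mul_choose_succ_le (n := m + 7) (m := m + 1) (k := k) (by omega)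
  have h3 := mul_choose_succ_le (n := m + 7) (m := m + 2) (k := k) (by omega)
  have h4 := mul_choose_succ_le (n := m + 7) (m := m + 3) (k := k) (by omega)
  rw [show m + 7 - 3 = m + 3 + 1 by omega, show m + 7 - 7 = m by omega]
  linarith

theorem exists_pow_lt_mul_choose (k : ℕ) (κ : ℝ) {δ : ℝ} (hδ : 0 < δ) :
    ∃ n₀ : ℕ, ∀ n ≥ n₀, κ * (n : ℝ) ^ k < δ * (n * (n - 7).choose k) := by
  obtain ⟨m, hm⟩ := exists_nat_gt (κ * (2 ^ k * k.factorial) / δ)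
  refine ⟨max m (2 * k + 20), fun n hn => ?_⟩
  have hn1 : m ≤ n := (le_max_left _ _).trans hn
  have hn2 : 2 * k + 20 ≤ n := (le_max_right _ _).trans hn
  have h1 : ((n - 7 + 1 - k : ℕ) : ℝ) ^ k ≤ k.factorial * (n - 7).choose k := by
    exact_mod_cast Nat.pow_sub_le_descFactorial (n - 7) k |>.trans
      (Nat.descFactorial_eq_factorial_mul_choose _ _).le
  have h2 : (n : ℝ) / 2 ≤ ((n - 7 + 1 - k : ℕ) : ℝ) := by
    have : n ≤ 2 * (n - 7 + 1 - k) := by omega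
    have : (n : ℝ) ≤ 2 * ((n - 7 + 1 - k : ℕ) : ℝ) := by exact_mod_cast this
    linarith
  have h3 : ((n : ℝ) / 2) ^ k ≤ k.factorial * (n - 7).choose k :=
    (pow_le_pow_left₀ (by positivity) h2 k).trans h1
  rw [div_pow, div_le_iff₀ (by positivity)] at h3
  have h4 : κ * (2 ^ k * k.factorial) < δ * n := by
    rw [div_lt_iff₀ hδ] at hm
    have : (m : ℝ) ≤ n := by exact_mod_cast hn1
    nlinarith
  have hnk : (0 : ℝ) < (n : ℝ) ^ k := by
    have : (0 : ℝ) < n := by exact_mod_cast (by omega : 0 < n)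
    positivity
  have hc : (0 : ℝ) < 2 ^ k * k.factorial := by positivity
  refine lt_of_mul_lt_mul_right ?_ hc.le
  calc κ * (n : ℝ) ^ k * (2 ^ k * k.factorial) = κ * (2 ^ k * k.factorial) * (n : ℝ) ^ k := by ring
    _ < δ * n * (n : ℝ) ^ k := mul_lt_mul_of_pos_right h4 hnk
    _ ≤ δ * n * (k.factorial * (n - 7).choose k * 2 ^ k) :=
        mul_le_mul_of_nonneg_left h3 (by positivity)
    _ = _ := by ring

end Asymptotics

/-! ### Comparison with the Fano families -/

section Main

variable {n r : ℕ} {C : ℝ} {F : Finset (Finset ℕ)}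

theorem diversity_le_diversity_two (hC : 2 ≤ C) : diversity n C F ≤ diversity n 2 F := by
  have : (0 : ℝ) ≤ maxDegree n F := Nat.cast_nonneg _
  simp only [diversity]
  nlinarith

/-- For C ≤ 2, d_C = (4 - 2C)d_{3/2} + (2C - 3)d_2 has leading coefficient at most (9/4)(4 - 2C),
which is below 7 - 3C by (3/2)C - 2 ≥ 1/4. For C ≥ 2 the bound on d_2 suffices. -/
theorem exists_forall_lt_of_small (r : ℕ) (hC : 3 / 2 ≤ C) (hC' : C < 7 / 3) (R : ℝ) (hR : 0 ≤ R) :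
    ∃ n₀ : ℕ, ∀ n ≥ n₀, ∀ F : Finset (Finset ℕ),
      n * diversity n 2 F ≤ R * (n : ℝ) ^ (r - 3) →
      n * diversity n (3 / 2) F ≤
        9 / 4 * (n * (n - 3).choose (r - 3)) + R * (n : ℝ) ^ (r - 3) →
      diversity n C F < (7 - 3 * C) * (n - 7).choose (r - 3) := by
  obtain ⟨n₁, h₁⟩ := exists_pow_lt_mul_choose (r - 3) (9 + 2 * R) (δ := 1 / 4) (by norm_num)
  obtain ⟨n₂, h₂⟩ := exists_pow_lt_mul_choose (r - 3) R (δ := 7 - 3 * C) (by linarith)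
  refine ⟨max (max n₁ n₂) 7, fun n hn F hd2 hd => ?_⟩
  have hn₁ : n₁ ≤ n := ((le_max_left _ _).trans (le_max_left _ _)).trans hn
  have hn₂ : n₂ ≤ n := ((le_max_right _ _).trans (le_max_left _ _)).trans hn
  have hn7 : 7 ≤ n := (le_max_right _ _).trans hn
  have hn0 : (0 : ℝ) < n := by exact_mod_cast (by omega : 0 < n)
  refine lt_of_mul_lt_mul_left ?_ hn0.le
  have hP : (0 : ℝ) ≤ (n : ℝ) ^ (r - 3) := by positivity
  obtain hC2 | hC2 := le_total C 2
  · have h3 : (n * (n - 3).choose (r - 3) : ℝ) ≤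
        n * (n - 7).choose (r - 3) + 4 * (n : ℝ) ^ (r - 3) := by
      exact_mod_cast mul_choose_sub_three_le (r - 3) hn7
    have hlin : n * diversity n C F = (4 - 2 * C) * (n * diversity n (3 / 2) F) +
        (2 * C - 3) * (n * diversity n 2 F) := by
      simp only [diversity]
      ring
    have e1 := mul_le_mul_of_nonneg_left hd (by linarith : 0 ≤ 4 - 2 * C)
    have e2 := mul_le_mul_of_nonneg_left hd2 (by linarith : 0 ≤ 2 * C - 3)
    have e3 := mul_le_mul_of_nonneg_left h3 (by linarith : 0 ≤ (4 - 2 * C) * (9 / 4))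
    have e4 := h₁ n hn₁
    have hN : (0 : ℝ) ≤ n * (n - 7).choose (r - 3) := by positivity
    have e5 := mul_nonneg (by linarith : 0 ≤ C - 3 / 2) hN
    have e6 := mul_nonneg (by linarith : 0 ≤ C - 3 / 2) hP
    have e7 : 0 ≤ R * (n : ℝ) ^ (r - 3) := mul_nonneg hR hP
    linarith
  · have e1 := mul_le_mul_of_nonneg_left (diversity_le_diversity_two (n := n) (F := F) hC2) hn0.le
    have e2 := h₂ n hn₂
    linarith

theorem exists_forall_sextuple_lt (hr : 3 ≤ r) (hC : 3 / 2 ≤ C) (hC' : C < 7 / 3)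
    (hrC : ¬ (r = 3 ∧ C = 3 / 2)) :
    ∃ n₀ : ℕ, ∀ n ≥ n₀, ∀ F : Finset (Finset ℕ),
      (∀ C : ℝ, 3 / 2 ≤ C → C ≤ 2 → diversity n C F ≤ (10 - 5 * C) * (n - 6).choose (r - 3)) →
      diversity n C F < max (diversity n C (familyFano n r))
        (diversity n C (familyFanoPlus n r)) := by
  obtain ⟨n₁, h₁⟩ := exists_pow_lt_mul_choose (r - 3) 3
    (δ := if C = 3 / 2 then 1 else 2 * C - 3) (by
      split_ifs with h
      · norm_num
      · have := lt_of_le_of_ne hC (Ne.symm h)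
        linarith)
  refine ⟨max n₁ (3 * r + 8), fun n hn F hF => ?_⟩
  have hn₁ : n₁ ≤ n := (le_max_left _ _).trans hn
  have hnr : 3 * r + 8 ≤ n := (le_max_right _ _).trans hn
  have hn0 : (0 : ℝ) < n := by exact_mod_cast (by omega : 0 < n)
  rw [diversity_familyFano hnr, diversity_familyFanoPlus hnr, lt_max_iff, traceCount, if_pos hr]
  have hN : (0 : ℝ) < (n - 7).choose (r - 3) := by
    exact_mod_cast Nat.choose_pos (by omega : r - 3 ≤ n - 7)
  by_cases hC3 : C = 3 / 2
  -- Both leading terms are 5/2 times `(n - 7).choose (r - 3)`; the next terms are 4 for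
  -- `familyFanoPlus` against 5/2, times `(n - 7).choose (r - 4)`, positive since r ≥ 4.
  · right
    have hr4 : 4 ≤ r := by
      by_contra h
      exact hrC ⟨by omega, hC3⟩
    have ht : (0 : ℝ) < (n - 7).choose (r - 4) := by
      exact_mod_cast Nat.choose_pos (by omega : r - 4 ≤ n - 7)
    have h6 : ((n - 6).choose (r - 3) : ℝ) = (n - 7).choose (r - 4) + (n - 7).choose (r - 3) := by
      rw [show n - 6 = n - 7 + 1 by omega, show r - 3 = r - 4 + 1 by omega,
        Nat.choose_succ_succ]
      push_cast
      rfl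
    have := hF C hC (by linarith)
    rw [traceCount, if_pos hr4]
    rw [h6] at this
    subst hC3
    linarith
  · left
    obtain hC2 | hC2 := le_total C 2
    · have e1 := h₁ n hn₁
      rw [if_neg hC3] at e1
      have h6 : (n * (n - 6).choose (r - 3) : ℝ) ≤
          n * (n - 7).choose (r - 3) + (n : ℝ) ^ (r - 3) := by
        have := mul_choose_succ_le (n := n) (m := n - 7) (k := r - 3) (by omega)
        rw [show n - 7 + 1 = n - 6 by omega] at this
        exact_mod_cast this
      refine lt_of_mul_lt_mul_left ?_ hn0.le
      have e2 := mul_le_mul_of_nonneg_left (hF C hC hC2) hn0.le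
      have e3 := mul_le_mul_of_nonneg_left h6 (by linarith : 0 ≤ 10 - 5 * C)
      have hP : (0 : ℝ) ≤ (n : ℝ) ^ (r - 3) := by positivity
      have e4 := mul_nonneg (by linarith : 0 ≤ C - 3 / 2) hP
      linarith
    · have e1 := (diversity_le_diversity_two (n := n) (F := F) hC2).trans
        (hF 2 (by norm_num) le_rfl)
      have := mul_pos (by linarith : 0 < 7 - 3 * C) hN
      linarith

/-- Extend f to a permutation of [n] and pull F back. Heavy triples meet every edge, so after the
pullback every line of the plane on [7] does. -/
theorem exists_relabel_meets_fano (hn : 7 ≤ n) (hF : IsIntersectingFamily n r F)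
    {f : ℕ → ℕ} (hf : Set.InjOn f (Icc 1 7 : Finset ℕ))
    (hfano : ∀ L ∈ fano, L.image f ∈ heavySets n r F) :
    ∃ σ : Equiv.Perm ℕ, PermutesVertices n σ ∧ ∃ G, F = relabel σ G ∧
      IsIntersectingFamily n r G ∧ ∀ E ∈ G, ∀ L ∈ fano, (E ∩ L).Nonempty := by
  have hline : ∀ i ∈ Icc 1 7, ∃ L ∈ fano, i ∈ L := by decide +kernel
  obtain ⟨σ, hσ, hσf⟩ := exists_permutesVertices f hn hf fun i hi => by
    obtain ⟨L, hL, hiL⟩ := hline i hi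
    exact subset_Icc_of_mem_heavySets (hfano L hL) (mem_image_of_mem f hiL)
  refine ⟨σ, hσ, relabel σ.symm F, (relabel_relabel_symm σ F).symm,
    isIntersectingFamily_relabel hσ.symm hF, fun E hE L hL => ?_⟩
  obtain ⟨E, hE', rfl⟩ := mem_image.1 hE
  obtain ⟨w, hw⟩ := inter_heavySet_nonempty hF hE' (hfano L hL)
  rw [mem_inter, mem_image] at hw
  obtain ⟨hwE, i, hi, rfl⟩ := hw
  refine ⟨i, mem_inter.2 ⟨mem_image.2 ⟨f i, hwE, ?_⟩, hi⟩⟩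
  rw [← hσf i (fanoPlus_subset L (fano_subset_fanoPlus hL) hi), σ.symm_apply_apply]

end Main
end Diversity

theorem theorem1p2 (r : ℕ) (hr : 3 ≤ r) (C : ℝ) (hC : 3 / 2 ≤ C) (hC' : C < 7 / 3)
    (hrC : ¬ (r = 3 ∧ C = 3 / 2)) :
    ∃ n₀ : ℕ, ∀ n : ℕ, n₀ ≤ n → ∀ F : Finset (Finset ℕ), Diversity.IsExtremal n r C F →
      (C < 7 / 4 → Diversity.Isomorphic n F (Diversity.familyFanoPlus n r)) ∧
      (C = 7 / 4 → ∃ σ : Equiv.Perm ℕ, Diversity.PermutesVertices n σ ∧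
        Diversity.relabel σ (Diversity.familyFano n r) ⊆ F ∧
        F ⊆ Diversity.relabel σ (Diversity.familyFanoPlus n r) ∧
        (∀ v ∈ Finset.Icc 1 7,
          ((F \ Diversity.relabel σ (Diversity.familyFano n r)).card : ℝ) -
            C * (Diversity.degree (F \ Diversity.relabel σ (Diversity.familyFano n r)) (σ v) : ℝ)
              = 0) ∧
        Diversity.diversity n C F =
          Diversity.diversity n C (Diversity.relabel σ (Diversity.familyFano n r))) ∧
      (7 / 4 < C → Diversity.Isomorphic n F (Diversity.familyFano n r)) := by
  open Diversity in
  obtain ⟨n₁, h₁⟩ := exists_forall_lt_of_small r hC hC' (2 * r ^ 4) (by positivity)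
  obtain ⟨n₂, h₂⟩ := exists_forall_sextuple_lt hr hC hC' hrC
  refine ⟨max (max n₁ n₂) (3 * r + 8), fun n hn F hF => ?_⟩
  have hn₁ : n₁ ≤ n := ((le_max_left _ _).trans (le_max_left _ _)).trans hn
  have hn₂ : n₂ ≤ n := ((le_max_right _ _).trans (le_max_left _ _)).trans hn
  have hnr : 3 * r + 8 ≤ n := (le_max_right _ _).trans hn
  have hmax : diversity n C (familyFano n r) ≤ diversity n C F :=
    hF.2 _ (isIntersectingFamily_traceFamily fun A hA B hB =>
      fanoPlus_inter_nonempty A (fano_subset_fanoPlus hA) B (fano_subset_fanoPlus hB))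
  have hmaxPlus : diversity n C (familyFanoPlus n r) ≤ diversity n C F :=
    hF.2 _ (isIntersectingFamily_traceFamily fanoPlus_inter_nonempty)
  obtain h | ⟨f, hf, hfano⟩ | ⟨X, hX, hX6, hHX, h10, hcov⟩ :=
    small_diversity_or_fano_or_sextuple (by omega) hr hF.1
  · have := h₁ n hn₁ F h.1 h.2
    rw [diversity_familyFano hnr, traceCount, if_pos hr] at hmax
    exact absurd hmax (not_le.2 this)
  · obtain ⟨σ, hσ, G, rfl, hG, hmeet⟩ := exists_relabel_meets_fano (by omega) hF.1 hf hfano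
    rw [diversity_relabel hσ] at hmax hmaxPlus ⊢
    refine ⟨fun hC4 => ⟨σ, hσ, ?_⟩, fun hC4 => ⟨σ, hσ, ?_⟩, fun hC4 => ⟨σ, hσ, ?_⟩⟩
    · rw [eq_familyFanoPlus hnr hC hC4 hG.1 hmeet hmaxPlus]
    · obtain ⟨e1, e2, e3, e4⟩ := between_familyFano hnr hC4 hG.1 hmeet hmax
      refine ⟨Finset.image_subset_image e1, Finset.image_subset_image e2, fun v hv => ?_, ?_⟩
      · rw [← relabel_sdiff, card_relabel, degree_relabel]
        exact e3 v hv
      · rw [diversity_relabel hσ, e4]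
    · rw [eq_familyFano hnr hC4 hC' hG.1 hmeet hmax]
  · have := h₂ n hn₂ F fun C hC hC2 => diversity_le_of_sextuple hr hF.1 hC hC2 hX hX6 hHX h10 hcov
    exact absurd (max_le hmax hmaxPlus) (not_le.2 this)
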